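/- Let $M,L\ge 1$, let $\sigma>0$, and let $\mathbf A\in\mathbb R^{L\times M}$ have full rank $\min\{M,L\}$. Let $\mathbf X\sim\mathcal N(\mathbf 0,\mathbf I_M)$ and $\mathbf W\sim\mathcal N(\mathbf 0,\sigma^2\mathbf I_L)$ be independent, and let $\mathbf Y=\mathbf A\mathbf X+\mathbf W$, with covariance matrix $\mathbf\Sigma_{\mathbf Y}=\mathbf A\mathbf A^T+\sigma^2\mathbf I_L$. For a symmetric matrix $\mathbf C$ let $\lambda_l(\mathbf C)$ denote its $l$-th largest eigenvalue (counted with multiplicity), and put $\lambda_l=\lambda_l(\mathbf A\mathbf A^T)$ for $1\le l\le L$. For a positive semidefinite matrix $\mathbf C$ define $R_1(\mathbf C)=0$, $R_k(\mathbf C)=\frac12\sum_{l=1}^k\log_2\frac{\lambda_l(\mathbf C)}{\lambda_k(\mathbf C)}$ for $2\le k\le\operatorname{rank}(\mathbf C)$, $R_{\operatorname{rank}(\mathbf C)+1}(\mathbf C)=\infty$, and, for $1\le k\le \operatorname{rank}(\mathbf C)$, $$\theta_k(\mathbf C,R)=2^{-2R/k}\Big(\prod_{l=1}^k\lambda_l(\mathbf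 C)\Big)^{1/k}.$$ A compress-and-estimate (CE) reconstruction of rate $R$ is a random vector $\widehat{\mathbf Y}$ in $\mathbb R^L$, generated from $\mathbf Y$ through a channel $P_{\widehat{\mathbf Y}|\mathbf Y}$ (so that $\mathbf X\to\mathbf Y\to\widehat{\mathbf Y}$ is a Markov chain), such that $(\mathbf Y,\widehat{\mathbf Y})$ is described by the backward Gaussian channel $\mathbf Y=\widehat{\mathbf Y}+\mathbf U\mathbf Z$, where $\mathbf U$ is an orthogonal matrix with $\mathbf U^T\mathbf\Sigma_{\mathbf Y}\mathbf U=\operatorname{diag}(\lambda_1+\sigma^2,\dots,\lambda_L+\sigma^2)$, the noise $\mathbf Z$ is independent of $\widehat{\mathbf Y}$ with $\mathbf Z\sim\mathcal N(\mathbf 0,\operatorname{diag}(D_1,\dots,D_L))$, $D_l=\min(\lambda_l+\sigma^2,\theta)$, and the level $\theta>0$ is such that the mutual information, in bits, is $I(\mathbf Y;\widehat{\mathbf Y})=R$. The CE distortion-rate function (CE-DRF) is the resulting normalized minimum mean square error $$D_{CE}(R)=\frac1M\,\mathbb E\big[\|\mathbf X-\mathbb E[\mathbf X\mid\widehat{\mathbf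 Y}]\|^2\big].$$ Let $1\le k\le\operatorname{rank}(\mathbf\Sigma_{\mathbf Y})$ and let $R\in\mathbb R$ satisfy $R_k(\mathbf\Sigma_{\mathbf Y})<R\le R_{k+1}(\mathbf\Sigma_{\mathbf Y})$. Then a CE reconstruction of rate $R$ exists, and every CE reconstruction of rate $R$ gives $$D_{CE}(R)=1-\frac1M\sum_{l=1}^k\frac{\lambda_l}{\lambda_l+\sigma^2}+\frac{\theta_k(\mathbf\Sigma_{\mathbf Y},R)}{M}\sum_{l=1}^k\frac{\lambda_l}{(\lambda_l+\sigma^2)^2}.$$ -/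

import Mathlib

open MeasureTheory ProbabilityTheory InformationTheory
open scoped Matrix ENNReal

noncomputable section

namespace CompressEstimate

/-- `nthEigenvalue C l` is the `l`-th largest eigenvalue (`l = 1, …, n`) of the real symmetric
`n × n` matrix `C`, eigenvalues being repeated according to their multiplicity. -/
def nthEigenvalue {n : ℕ} (C : Matrix (Fin n) (Fin n) ℝ) (l : ℕ) : ℝ :=
  (C.charpoly.roots.sort (· ≥ ·)).getD (l - 1) 0

/-- The rate thresholds `R_k(C)`, in bits, for `1 ≤ k ≤ rank C + 1`: zero for `k = 1`,
`½ ∑_{l ≤ k} log₂ (λ_l(C) / λ_k(C))` for `2 ≤ k ≤ rank C`, and `∞` for `k = rank C + 1`. -/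
def rateThreshold {n : ℕ} (C : Matrix (Fin n) (Fin n) ℝ) (k : ℕ) : EReal :=
  if k = 1 then 0
  else if k ≤ C.rank then
    ((1 / 2 * ∑ l ∈ Finset.Icc 1 k,
      Real.logb 2 (nthEigenvalue C l / nthEigenvalue C k) : ℝ) : EReal)
  else ⊤

/-- `θ_k(C, R) = 2 ^ (-2R/k) * (∏_{l ≤ k} λ_l(C)) ^ (1/k)`. -/
def waterLevel {n : ℕ} (C : Matrix (Fin n) (Fin n) ℝ) (k : ℕ) (R : ℝ) : ℝ :=
  (2 : ℝ) ^ (-(2 * R) / (k : ℝ)) *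
    (∏ l ∈ Finset.Icc 1 k, nthEigenvalue C l) ^ (1 / (k : ℝ))

/-- The mutual information, in bits, of the two coordinates under a joint law. -/
def mutualInfoBits {α β : Type*} [MeasurableSpace α] [MeasurableSpace β]
    (μ : Measure (α × β)) : ℝ≥0∞ :=
  klDiv μ (μ.fst.prod μ.snd) / ENNReal.ofReal (Real.log 2)

variable {M L : ℕ}

/-- The joint law of `(X, Y)`, where `Y = A X + W` with `X ∼ N(0, I_M)` and `W ∼ N(0, σ² I_L)`
independent. -/
def sourceObsLaw (A : Matrix (Fin L) (Fin M) ℝ) (σ : ℝ) :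
    Measure (EuclideanSpace ℝ (Fin M) × EuclideanSpace ℝ (Fin L)) :=
  ((multivariateGaussian 0 (1 : Matrix (Fin M) (Fin M) ℝ)).prod
    (multivariateGaussian 0 (σ ^ 2 • (1 : Matrix (Fin L) (Fin L) ℝ)))).map
      (fun p => (p.1, A.toEuclideanLin p.1 + p.2))

/-- The covariance matrix `Σ_Y = A Aᵀ + σ² I` of `Y`. -/
def obsCov (A : Matrix (Fin L) (Fin M) ℝ) (σ : ℝ) : Matrix (Fin L) (Fin L) ℝ :=
  A * Aᵀ + σ ^ 2 • (1 : Matrix (Fin L) (Fin L) ℝ)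

/-- The joint law of `((X, Y), Ŷ)`, where the reconstruction `Ŷ` is the output of the test channel
`κ = P_{Ŷ|Y}` with input `Y` (so `X`, `Y`, `Ŷ` is a Markov chain). -/
def jointLaw (A : Matrix (Fin L) (Fin M) ℝ) (σ : ℝ)
    (κ : Kernel (EuclideanSpace ℝ (Fin L)) (EuclideanSpace ℝ (Fin L))) :
    Measure ((EuclideanSpace ℝ (Fin M) × EuclideanSpace ℝ (Fin L)) ×
      EuclideanSpace ℝ (Fin L)) :=
  sourceObsLaw A σ ⊗ₘ κ.comap Prod.snd measurable_snd

/-- The joint law of `(Y, Ŷ)`. -/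
def obsRecLaw (A : Matrix (Fin L) (Fin M) ℝ) (σ : ℝ)
    (κ : Kernel (EuclideanSpace ℝ (Fin L)) (EuclideanSpace ℝ (Fin L))) :
    Measure (EuclideanSpace ℝ (Fin L) × EuclideanSpace ℝ (Fin L)) :=
  (jointLaw A σ κ).map (fun p => (p.1.2, p.2))

/-- `κ = P_{Ŷ|Y}` is a compress-and-estimate test channel of rate `R` bits: `(Y, Ŷ)` is described
by the backward Gaussian channel `Y = Ŷ + U Z` with `Z` independent of `Ŷ`, where `U` is an
orthogonal matrix that diagonalizes `Σ_Y`, the noise is `Z ∼ N(0, diag (D_1, …, D_L))` with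
`D_l = min (λ_l + σ², θ)`, the numbers `λ_l` are the eigenvalues of `A Aᵀ` in descending order,
and the level `θ > 0` is such that `I(Y; Ŷ) = R`. -/
def IsCETestChannel (A : Matrix (Fin L) (Fin M) ℝ) (σ R : ℝ)
    (κ : Kernel (EuclideanSpace ℝ (Fin L)) (EuclideanSpace ℝ (Fin L))) : Prop :=
  mutualInfoBits (obsRecLaw A σ κ) = ENNReal.ofReal R ∧
  ∃ U : Matrix (Fin L) (Fin L) ℝ, U ∈ Matrix.orthogonalGroup (Fin L) ℝ ∧
    Uᵀ * obsCov A σ * U =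
      Matrix.diagonal (fun l : Fin L => nthEigenvalue (A * Aᵀ) (l + 1) + σ ^ 2) ∧
    ∃ θ : ℝ, 0 < θ ∧
      obsRecLaw A σ κ =
        ((obsRecLaw A σ κ).snd.prod (multivariateGaussian 0 (Matrix.diagonal
          (fun l : Fin L => min (nthEigenvalue (A * Aᵀ) (l + 1) + σ ^ 2) θ)))).map
            (fun p => (p.1 + U.toEuclideanLin p.2, p.1))

/-- The normalized minimum mean square error `(1/M) E ‖X - E[X | Ŷ]‖²`. -/
def ceDistortion (A : Matrix (Fin L) (Fin M) ℝ) (σ : ℝ)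
    (κ : Kernel (EuclideanSpace ℝ (Fin L)) (EuclideanSpace ℝ (Fin L))) : ℝ :=
  1 / (M : ℝ) * ∫ p, ‖p.1.1 -
    ((jointLaw A σ κ)[fun q => q.1.1 | MeasurableSpace.comap Prod.snd inferInstance]) p‖ ^ 2
      ∂(jointLaw A σ κ)

/-- `D` is the value `D_CE(R)` of the compress-and-estimate distortion-rate function: a
compress-and-estimate test channel of rate `R` exists, and each of them gives the normalized
distortion `D` when `X` is estimated by `E[X | Ŷ]`. -/
def IsCEDRF (A : Matrix (Fin L) (Fin M) ℝ) (σ R D : ℝ) : Prop :=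
  (∃ κ : Kernel (EuclideanSpace ℝ (Fin L)) (EuclideanSpace ℝ (Fin L)),
    IsMarkovKernel κ ∧ IsCETestChannel A σ R κ) ∧
  ∀ κ : Kernel (EuclideanSpace ℝ (Fin L)) (EuclideanSpace ℝ (Fin L)),
    IsMarkovKernel κ → IsCETestChannel A σ R κ → ceDistortion A σ κ = D

end CompressEstimate

end

/-! Write `μ_l = λ_l + σ²` and let `B` be the Wiener matrix, which satisfies `B Σ_Y = Aᵀ`. The error
`X - B Y` is independent of `Y` (`map_sub_sourceObsLaw`). Since `Ŷ` is produced from `Y` alone, this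
error is independent of the pair `(Y, Ŷ)` (`map_jointLaw`). Inserting `Y = Ŷ + U Z` gives `X - B Ŷ =
(X - B Y) + B U Z`, which is centred and independent of `Ŷ`. Hence `E[X | Ŷ] = B Ŷ`, and the error
energy is a sum of two traces (`ceDistortion_of_backward_channel`). The matrix `U` also diagonalizes
`A Aᵀ`, so the energy becomes `M - ∑ λ_l (μ_l - D_l) / μ_l²` (`ceDistortion_eq_sum`).

The rate is a difference of Gaussian differential entropies, `½ ∑ log₂ (μ_l / D_l)`
(`mutualInfoBits_backward_channel`). With `D_l = min(μ_l, θ)` it is strictly decreasing in `θ` below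
`μ_1`, so a positive rate determines `θ`. The bounds `R_k < R ≤ R_{k+1}` say exactly that the
explicit level `θ_k` satisfies `μ_{k+1} ≤ θ_k < μ_k`, so that it solves the rate equation with the
first `k` components active. The remaining components have `D_l = μ_l` and drop out of both sums.

For existence, the backward channel is built as a joint law with the correct `Y`-marginal and then
disintegrated (`exists_backward_channel`). -/

noncomputable section

namespace CompressEstimate

/-! ### Ordered eigenvalues and orthogonal diagonalization of `A Aᵀ` and `Σ_Y`. -/

section Spectral

lemma nthEigenvalue_eq_eigenvalues₀ {n : ℕ} {C : Matrix (Fin n) (Fin n) ℝ} (hC : C.IsHermitian)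
    (l : Fin n) :
    nthEigenvalue C (l + 1) = hC.eigenvalues₀ (Fin.cast (Fintype.card_fin n).symm l) := by
  have h := hC.sort_roots_charpoly_eq_eigenvalues₀
  simp at h
  rw [nthEigenvalue, h]
  simp

lemma antitone_nthEigenvalue {n : ℕ} {C : Matrix (Fin n) (Fin n) ℝ} (hC : C.IsHermitian) :
    Antitone fun l : Fin n => nthEigenvalue C (l + 1) := by
  intro i j hij
  simp only [nthEigenvalue_eq_eigenvalues₀ hC]
  exact hC.eigenvalues₀_antitone hij

lemma exists_orthogonal_diagonalization {n : ℕ} {C : Matrix (Fin n) (Fin n) ℝ}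
    (hC : C.IsHermitian) : ∃ U ∈ Matrix.orthogonalGroup (Fin n) ℝ,
      Uᵀ * C * U = Matrix.diagonal fun l : Fin n => nthEigenvalue C (l + 1) := by
  -- `eigenvalues` is the sorted family `eigenvalues₀` reindexed by an unspecified bijection;
  -- permuting the eigenvector columns by `e` restores descending order.
  let e : Fin n ≃ Fin n :=
    (finCongr (Fintype.card_fin n).symm).trans (Fintype.equivOfCardEq (Fintype.card_fin _))
  have he : ∀ l : Fin n, nthEigenvalue C (l + 1) = hC.eigenvalues (e l) := by
    intro l
    rw [nthEigenvalue_eq_eigenvalues₀ hC]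
    simp [e, Matrix.IsHermitian.eigenvalues]
  let V : Matrix (Fin n) (Fin n) ℝ := hC.eigenvectorUnitary
  have hV : Vᵀ * V = 1 := by
    have := Unitary.coe_star_mul_self hC.eigenvectorUnitary
    simpa [V, Matrix.star_eq_conjTranspose] using this
  have hd : Vᵀ * C * V = Matrix.diagonal hC.eigenvalues := by
    have := hC.conjStarAlgAut_star_eigenvectorUnitary
    rw [Unitary.conjStarAlgAut_apply] at this
    simpa [V, Matrix.star_eq_conjTranspose, Function.comp_def] using this
  refine ⟨V.submatrix id e, ?_, ?_⟩
  · rw [Matrix.mem_orthogonalGroup_iff']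
    change (V.submatrix id e)ᵀ * V.submatrix id e = 1
    rw [Matrix.transpose_submatrix, ← Matrix.submatrix_mul _ _ _ _ _ Function.bijective_id, hV]
    exact Matrix.submatrix_one_equiv e
  · have : Matrix.diagonal (fun l : Fin n => nthEigenvalue C (l + 1))
        = (Matrix.diagonal hC.eigenvalues).submatrix e e := by
      rw [Matrix.submatrix_diagonal_equiv]
      congr 1
      ext l
      exact he l
    rw [this, ← hd, Matrix.transpose_submatrix]
    ext i j
    simp [Matrix.mul_apply]

/-- Conjugation preserves the characteristic polynomial, and an antitone diagonal is already the
sorted list of its roots. -/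
lemma nthEigenvalue_eq_of_diagonalization {n : ℕ} {C U : Matrix (Fin n) (Fin n) ℝ} {d : Fin n → ℝ}
    (hU : U ∈ Matrix.orthogonalGroup (Fin n) ℝ) (hd : Antitone d)
    (h : Uᵀ * C * U = Matrix.diagonal d) (l : Fin n) : nthEigenvalue C (l + 1) = d l := by
  have hU' : U * Uᵀ = 1 := by
    simpa [Matrix.star_eq_conjTranspose] using (Matrix.mem_orthogonalGroup_iff _ _).1 hU
  have hroots : C.charpoly.roots = (List.ofFn d : Multiset ℝ) := by
    have : (Matrix.diagonal d).charpoly = C.charpoly := by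
      rw [← h, Matrix.charpoly_mul_comm, ← mul_assoc, hU', one_mul]
    rw [← this, Matrix.charpoly_diagonal,
      show ∏ i, (Polynomial.X - Polynomial.C (d i)) =
        ((Finset.univ.val.map d).map fun a => Polynomial.X - Polynomial.C a).prod by
          simp [Finset.prod, Function.comp_def],
      Polynomial.roots_multiset_prod_X_sub_C]
    simp [List.ofFn_eq_map]
  have hs : C.charpoly.roots.sort (· ≥ ·) = List.ofFn d := by
    rw [hroots, Multiset.coe_sort]
    exact List.mergeSort_eq_self _ hd.sortedGE_ofFn.pairwise
  simp [nthEigenvalue, hs]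

variable {M L : ℕ}

lemma transpose_mul_self_of_mem_orthogonalGroup {U : Matrix (Fin L) (Fin L) ℝ}
    (hU : U ∈ Matrix.orthogonalGroup (Fin L) ℝ) : Uᵀ * U = 1 := by
  simpa [Matrix.star_eq_conjTranspose] using (Matrix.mem_orthogonalGroup_iff' _ _).1 hU

lemma self_mul_transpose_of_mem_orthogonalGroup {U : Matrix (Fin L) (Fin L) ℝ}
    (hU : U ∈ Matrix.orthogonalGroup (Fin L) ℝ) : U * Uᵀ = 1 := by
  simpa [Matrix.star_eq_conjTranspose] using (Matrix.mem_orthogonalGroup_iff _ _).1 hU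

lemma posSemidef_self_mul_transpose (A : Matrix (Fin L) (Fin M) ℝ) : (A * Aᵀ).PosSemidef := by
  simpa using Matrix.posSemidef_self_mul_conjTranspose A

lemma nthEigenvalue_gram_nonneg (A : Matrix (Fin L) (Fin M) ℝ) (l : Fin L) :
    0 ≤ nthEigenvalue (A * Aᵀ) (l + 1) := by
  have h := posSemidef_self_mul_transpose A
  obtain ⟨U, -, hd⟩ := exists_orthogonal_diagonalization h.isHermitian
  have h2 : (Uᵀ * (A * Aᵀ) * U).PosSemidef := by
    simpa using h.conjTranspose_mul_mul_same U
  rw [hd, Matrix.posSemidef_diagonal_iff] at h2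
  exact h2 l

/-- The term `σ² I` is fixed by orthogonal conjugation. Thus any `U` allowed in a test channel also
diagonalizes `A Aᵀ`, even when eigenvalues repeat. -/
lemma transpose_mul_obsCov_mul {A : Matrix (Fin L) (Fin M) ℝ} {σ : ℝ}
    {U : Matrix (Fin L) (Fin L) ℝ} (hU : U ∈ Matrix.orthogonalGroup (Fin L) ℝ) (d : Fin L → ℝ) :
    Uᵀ * obsCov A σ * U = Matrix.diagonal (fun l => d l + σ ^ 2) ↔
      Uᵀ * (A * Aᵀ) * U = Matrix.diagonal d := by
  have h1 : Uᵀ * obsCov A σ * U = Uᵀ * (A * Aᵀ) * U + σ ^ 2 • 1 := by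
    rw [obsCov, Matrix.mul_add, Matrix.add_mul]
    simp [transpose_mul_self_of_mem_orthogonalGroup hU]
  have h2 : Matrix.diagonal (fun l => d l + σ ^ 2) =
      Matrix.diagonal d + σ ^ 2 • (1 : Matrix (Fin L) (Fin L) ℝ) := by
    rw [Matrix.smul_one_eq_diagonal, Matrix.diagonal_add]
  rw [h1, h2, add_left_inj]

lemma nthEigenvalue_obsCov (A : Matrix (Fin L) (Fin M) ℝ) (σ : ℝ) (l : Fin L) :
    nthEigenvalue (obsCov A σ) (l + 1) = nthEigenvalue (A * Aᵀ) (l + 1) + σ ^ 2 := by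
  have hH := (posSemidef_self_mul_transpose A).isHermitian
  obtain ⟨U, hU, hd⟩ := exists_orthogonal_diagonalization hH
  refine nthEigenvalue_eq_of_diagonalization
    (d := fun l => nthEigenvalue (A * Aᵀ) (l + 1) + σ ^ 2) hU ?_
    ((transpose_mul_obsCov_mul hU _).2 hd) l
  exact (antitone_nthEigenvalue hH).add_const _

lemma rank_obsCov (A : Matrix (Fin L) (Fin M) ℝ) {σ : ℝ} (hσ : 0 < σ) :
    (obsCov A σ).rank = L := by
  have h : (obsCov A σ).PosDef :=
    Matrix.PosDef.posSemidef_add (posSemidef_self_mul_transpose A)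
      (Matrix.PosDef.one.smul (by positivity))
  simpa using Matrix.rank_of_isUnit _ h.isUnit

end Spectral

/-! ### Centred multivariate Gaussians: linear images, sums, second moments. -/

section Gaussian

variable {m n : ℕ}

lemma inner_eq_dotProduct (x y : EuclideanSpace ℝ (Fin n)) : inner ℝ x y = x.ofLp ⬝ᵥ y.ofLp := by
  simp [PiLp.inner_apply, dotProduct, mul_comm]

lemma inner_toEuclideanLin (B : Matrix (Fin m) (Fin n) ℝ) (x : EuclideanSpace ℝ (Fin n))
    (t : EuclideanSpace ℝ (Fin m)) :
    inner ℝ (B.toEuclideanLin x) t = inner ℝ x (Bᵀ.toEuclideanLin t) := by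
  rw [inner_eq_dotProduct, inner_eq_dotProduct]
  simp [Matrix.toLpLin_apply, Matrix.dotProduct_mulVec, Matrix.vecMul_transpose]

@[fun_prop]
lemma continuous_toEuclideanLin (B : Matrix (Fin m) (Fin n) ℝ) :
    Continuous (fun x => B.toEuclideanLin x) :=
  B.toEuclideanLin.continuous_of_finiteDimensional

@[fun_prop]
lemma measurable_toEuclideanLin (B : Matrix (Fin m) (Fin n) ℝ) :
    Measurable (fun x => B.toEuclideanLin x) := (continuous_toEuclideanLin B).measurable

lemma toEuclideanLin_mul_apply {p : ℕ} (B : Matrix (Fin m) (Fin n) ℝ) (C : Matrix (Fin n) (Fin p) ℝ)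
    (x : EuclideanSpace ℝ (Fin p)) :
    (B * C).toEuclideanLin x = B.toEuclideanLin (C.toEuclideanLin x) := by
  simp [Matrix.toLpLin_apply]

lemma charFun_map_toEuclideanLin (B : Matrix (Fin m) (Fin n) ℝ)
    (μ : Measure (EuclideanSpace ℝ (Fin n))) (t : EuclideanSpace ℝ (Fin m)) :
    charFun (μ.map (fun x => B.toEuclideanLin x)) t = charFun μ (Bᵀ.toEuclideanLin t) := by
  rw [charFun_apply, charFun_apply, integral_map (by fun_prop) (by fun_prop)]
  simp_rw [inner_toEuclideanLin]

lemma charFun_centered_multivariateGaussian {S : Matrix (Fin n) (Fin n) ℝ} (hS : S.PosSemidef)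
    (t : EuclideanSpace ℝ (Fin n)) : charFun (multivariateGaussian 0 S) t =
      Complex.exp ((-(inner ℝ t (S.toEuclideanLin t) / 2) : ℝ) : ℂ) := by
  rw [charFun_multivariateGaussian hS, inner_eq_dotProduct t (S.toEuclideanLin t)]
  simp [Matrix.toLpLin_apply]

lemma map_toEuclideanLin_multivariateGaussian (B : Matrix (Fin m) (Fin n) ℝ)
    {S : Matrix (Fin n) (Fin n) ℝ} (hS : S.PosSemidef) :
    (multivariateGaussian 0 S).map (fun x => B.toEuclideanLin x) =
      multivariateGaussian 0 (B * S * Bᵀ) := by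
  have : IsProbabilityMeasure ((multivariateGaussian 0 S).map (fun x => B.toEuclideanLin x)) :=
    Measure.isProbabilityMeasure_map (by fun_prop)
  apply Measure.ext_of_charFun
  ext t
  rw [charFun_map_toEuclideanLin, charFun_multivariateGaussian hS,
    charFun_multivariateGaussian (by simpa using hS.mul_mul_conjTranspose_same B)]
  simp [Matrix.toLpLin_apply, Matrix.dotProduct_mulVec, Matrix.vecMul_mulVec]
  simp [← Matrix.vecMul_vecMul, Matrix.vecMul_transpose]

lemma map_add_prod_multivariateGaussian {S T : Matrix (Fin n) (Fin n) ℝ} (hS : S.PosSemidef)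
    (hT : T.PosSemidef) :
    ((multivariateGaussian 0 S).prod (multivariateGaussian 0 T)).map (fun p => p.1 + p.2) =
      multivariateGaussian 0 (S + T) := by
  change (multivariateGaussian 0 S) ∗ (multivariateGaussian 0 T) = _
  apply Measure.ext_of_charFun
  ext t
  rw [charFun_conv, charFun_multivariateGaussian hS, charFun_multivariateGaussian hT,
    charFun_multivariateGaussian (hS.add hT), ← Complex.exp_add]
  congr 1
  simp [Matrix.add_mulVec]
  ring

lemma multivariateGaussian_diagonal {d : Fin n → ℝ} (hd : ∀ i, 0 ≤ d i) :
    multivariateGaussian 0 (Matrix.diagonal d) =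
      (Measure.pi fun i => gaussianReal 0 (d i).toNNReal).map (WithLp.toLp 2) := by
  have : IsProbabilityMeasure
      ((Measure.pi fun i => gaussianReal 0 (d i).toNNReal).map (WithLp.toLp 2)) :=
    Measure.isProbabilityMeasure_map (by fun_prop)
  apply Measure.ext_of_charFun
  ext t
  rw [charFun_pi, charFun_multivariateGaussian (Matrix.PosSemidef.diagonal hd)]
  simp_rw [charFun_gaussianReal, ← Complex.exp_sum]
  congr 1
  simp [dotProduct, Matrix.mulVec_diagonal, hd, Finset.sum_div, ← Finset.sum_neg_distrib]
  refine Finset.sum_congr rfl fun i _ => ?_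
  ring

lemma integrable_norm_sq_multivariateGaussian (S : Matrix (Fin n) (Fin n) ℝ) :
    Integrable (fun x => ‖x‖ ^ 2) (multivariateGaussian 0 S) :=
  (IsGaussian.memLp_two_id (μ := multivariateGaussian 0 S)).integrable_norm_pow (by norm_num)

lemma integrable_coord_sq_multivariateGaussian (S : Matrix (Fin n) (Fin n) ℝ) (i : Fin n) :
    Integrable (fun x => x i ^ 2) (multivariateGaussian 0 S) := by
  refine (integrable_norm_sq_multivariateGaussian S).mono' (by fun_prop) (ae_of_all _ fun x => ?_)
  rw [EuclideanSpace.norm_sq_eq]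
  simpa using Finset.single_le_sum (f := fun i => x i ^ 2) (fun i _ => sq_nonneg _)
    (Finset.mem_univ i)

lemma integral_coord_sq_multivariateGaussian {S : Matrix (Fin n) (Fin n) ℝ} (hS : S.PosSemidef)
    (i : Fin n) : ∫ x, x i ^ 2 ∂(multivariateGaussian 0 S) = S i i := by
  have h := measurePreserving_eval_multivariateGaussian (μ := 0) hS (i := i)
  have h2 : ∫ x, x i ^ 2 ∂(multivariateGaussian 0 S) =
      ∫ y, y ^ 2 ∂(gaussianReal 0 (S i i).toNNReal) := by
    rw [← show (0 : EuclideanSpace ℝ (Fin n)) i = (0 : ℝ) from rfl, ← h.map_eq,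
      integral_map (by fun_prop) (by fun_prop)]
  rw [h2]
  have h3 := variance_fun_id_gaussianReal (μ := 0) (v := (S i i).toNNReal)
  rw [variance_eq_integral (by fun_prop)] at h3
  simpa [hS.diag_nonneg] using h3

lemma integral_norm_sq_multivariateGaussian {S : Matrix (Fin n) (Fin n) ℝ} (hS : S.PosSemidef) :
    ∫ x, ‖x‖ ^ 2 ∂(multivariateGaussian 0 S) = S.trace := by
  simp_rw [EuclideanSpace.norm_sq_eq, Real.norm_eq_abs, sq_abs]
  rw [integral_finsetSum]
  · simp [integral_coord_sq_multivariateGaussian hS, Matrix.trace]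
  · exact fun i _ => integrable_coord_sq_multivariateGaussian S i

end Gaussian

/-! ### The source, the observation and the Markov chain. -/

section SourceLaw

variable {M L : ℕ}

instance (A : Matrix (Fin L) (Fin M) ℝ) (σ : ℝ) : IsProbabilityMeasure (sourceObsLaw A σ) :=
  Measure.isProbabilityMeasure_map (by fun_prop)

instance (A : Matrix (Fin L) (Fin M) ℝ) (σ : ℝ)
    (κ : Kernel (EuclideanSpace ℝ (Fin L)) (EuclideanSpace ℝ (Fin L))) [IsMarkovKernel κ] :
    IsProbabilityMeasure (jointLaw A σ κ) := by
  unfold jointLaw; infer_instance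

instance (A : Matrix (Fin L) (Fin M) ℝ) (σ : ℝ)
    (κ : Kernel (EuclideanSpace ℝ (Fin L)) (EuclideanSpace ℝ (Fin L))) [IsMarkovKernel κ] :
    IsProbabilityMeasure (obsRecLaw A σ κ) :=
  Measure.isProbabilityMeasure_map (by fun_prop)

lemma sq_smul_one_posSemidef (σ : ℝ) :
    (σ ^ 2 • (1 : Matrix (Fin L) (Fin L) ℝ)).PosSemidef :=
  Matrix.PosSemidef.one.smul (sq_nonneg σ)

lemma posSemidef_obsCov (A : Matrix (Fin L) (Fin M) ℝ) (σ : ℝ) : (obsCov A σ).PosSemidef :=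
  (posSemidef_self_mul_transpose A).add (sq_smul_one_posSemidef σ)

lemma snd_sourceObsLaw (A : Matrix (Fin L) (Fin M) ℝ) (σ : ℝ) :
    (sourceObsLaw A σ).snd = multivariateGaussian 0 (obsCov A σ) := by
  have h1 : (multivariateGaussian 0 (1 : Matrix (Fin M) (Fin M) ℝ)).map
      (fun x => A.toEuclideanLin x) = multivariateGaussian 0 (A * Aᵀ) := by
    rw [map_toEuclideanLin_multivariateGaussian _ Matrix.PosSemidef.one, Matrix.mul_one]
  rw [obsCov, ← map_add_prod_multivariateGaussian (posSemidef_self_mul_transpose A)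
    (sq_smul_one_posSemidef σ), ← h1,
    ← Measure.map_id (μ := multivariateGaussian 0 (σ ^ 2 • 1)),
    Measure.map_prod_map _ _ (by fun_prop) measurable_id,
    Measure.map_map (by fun_prop) (by fun_prop), Measure.snd, sourceObsLaw,
    Measure.map_map (by fun_prop) (by fun_prop)]
  rfl

lemma fst_sourceObsLaw (A : Matrix (Fin L) (Fin M) ℝ) (σ : ℝ) :
    (sourceObsLaw A σ).fst = multivariateGaussian 0 1 := by
  rw [Measure.fst, sourceObsLaw, Measure.map_map (by fun_prop) (by fun_prop)]
  change Measure.map Prod.fst _ = _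
  rw [Measure.map_fst_prod]
  simp

lemma lintegral_jointLaw (A : Matrix (Fin L) (Fin M) ℝ) (σ : ℝ)
    (κ : Kernel (EuclideanSpace ℝ (Fin L)) (EuclideanSpace ℝ (Fin L))) [IsMarkovKernel κ]
    {f : (EuclideanSpace ℝ (Fin M) × EuclideanSpace ℝ (Fin L)) ×
      EuclideanSpace ℝ (Fin L) → ℝ≥0∞} (hf : Measurable f) :
    ∫⁻ p, f p ∂(jointLaw A σ κ) = ∫⁻ q, ∫⁻ z, f (q, z) ∂(κ q.2) ∂(sourceObsLaw A σ) := by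
  rw [jointLaw, Measure.lintegral_compProd hf]
  rfl

lemma obsRecLaw_eq_compProd (A : Matrix (Fin L) (Fin M) ℝ) (σ : ℝ)
    (κ : Kernel (EuclideanSpace ℝ (Fin L)) (EuclideanSpace ℝ (Fin L))) [IsMarkovKernel κ] :
    obsRecLaw A σ κ = multivariateGaussian 0 (obsCov A σ) ⊗ₘ κ := by
  rw [← snd_sourceObsLaw]
  refine Measure.ext_of_lintegral _ fun f hf => ?_
  rw [obsRecLaw, lintegral_map hf (by fun_prop), lintegral_jointLaw _ _ _ (by fun_prop),
    Measure.lintegral_compProd hf, Measure.snd, lintegral_map (by fun_prop) (by fun_prop)]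

lemma fst_obsRecLaw (A : Matrix (Fin L) (Fin M) ℝ) (σ : ℝ)
    (κ : Kernel (EuclideanSpace ℝ (Fin L)) (EuclideanSpace ℝ (Fin L))) [IsMarkovKernel κ] :
    (obsRecLaw A σ κ).fst = multivariateGaussian 0 (obsCov A σ) := by
  rw [obsRecLaw_eq_compProd, Measure.fst_compProd]

/-- If `B Σ_Y = Aᵀ` then the linear estimation error `X - B Y` is independent of `Y`. -/
lemma map_sub_sourceObsLaw (A : Matrix (Fin L) (Fin M) ℝ) (σ : ℝ) {B : Matrix (Fin M) (Fin L) ℝ}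
    (hB : B * obsCov A σ = Aᵀ) :
    (sourceObsLaw A σ).map (fun q => (q.1 - B.toEuclideanLin q.2, q.2)) =
      ((sourceObsLaw A σ).map fun q => q.1 - B.toEuclideanLin q.2).prod
        (multivariateGaussian 0 (obsCov A σ)) := by
  -- Collecting terms in `⟨s, X - B Y⟩ + ⟨t, Y⟩`: the coefficient of `W` is `t - Bᵀ s`, and that of
  -- `X` is `s + Aᵀ (t - Bᵀ s)`.
  have hψ : ∀ s t, charFun (((sourceObsLaw A σ).map
      (fun q => (q.1 - B.toEuclideanLin q.2, q.2))).map (WithLp.toLp 2)) (WithLp.toLp 2 (s, t)) =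
      charFun (multivariateGaussian 0 (1 : Matrix (Fin M) (Fin M) ℝ))
        (s + Aᵀ.toEuclideanLin (t - Bᵀ.toEuclideanLin s)) *
      charFun (multivariateGaussian 0 (σ ^ 2 • (1 : Matrix (Fin L) (Fin L) ℝ)))
        (t - Bᵀ.toEuclideanLin s) := by
    intro s t
    rw [sourceObsLaw, Measure.map_map (by fun_prop) (by fun_prop),
      Measure.map_map (by fun_prop) (by fun_prop), charFun_apply, charFun_apply, charFun_apply,
      integral_map (by fun_prop) (by fun_prop), ← integral_prod_mul]
    refine integral_congr_ae (ae_of_all _ fun p => ?_)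
    beta_reduce
    rw [← Complex.exp_add]
    congr 1
    simp only [Function.comp_def, WithLp.prod_inner_apply]
    rw [← add_mul, ← Complex.ofReal_add]
    congr 2
    simp only [inner_sub_left, inner_add_left, inner_add_right, inner_sub_right, map_add, map_sub,
      inner_toEuclideanLin]
    ring
  have hG : ∀ s, charFun ((sourceObsLaw A σ).map fun q => q.1 - B.toEuclideanLin q.2) s =
      charFun (((sourceObsLaw A σ).map
        (fun q => (q.1 - B.toEuclideanLin q.2, q.2))).map (WithLp.toLp 2))
          (WithLp.toLp 2 (s, 0)) := by
    intro s
    rw [Measure.map_map (by fun_prop) (by fun_prop), charFun_apply, charFun_apply,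
      integral_map (by fun_prop) (by fun_prop), integral_map (by fun_prop) (by fun_prop)]
    simp [WithLp.prod_inner_apply]
  have : IsProbabilityMeasure
      ((sourceObsLaw A σ).map (fun q => (q.1 - B.toEuclideanLin q.2, q.2))) :=
    Measure.isProbabilityMeasure_map (by fun_prop)
  have : IsProbabilityMeasure ((sourceObsLaw A σ).map fun q => q.1 - B.toEuclideanLin q.2) :=
    Measure.isProbabilityMeasure_map (by fun_prop)
  refine charFun_eq_prod_iff.1 fun r => ?_
  obtain ⟨s, t⟩ := r
  have hcov : B.toEuclideanLin (A.toEuclideanLin (Aᵀ.toEuclideanLin t)) +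
      σ ^ 2 • B.toEuclideanLin t = Aᵀ.toEuclideanLin t := by
    conv_rhs => rw [← hB]
    rw [obsCov, Matrix.mul_add, map_add, LinearMap.add_apply, toEuclideanLin_mul_apply,
      toEuclideanLin_mul_apply, Matrix.mul_smul, Matrix.mul_one, map_smul, LinearMap.smul_apply]
  set v := Aᵀ.toEuclideanLin t with hv
  set w := Bᵀ.toEuclideanLin s with hw
  set r := s - Aᵀ.toEuclideanLin w with hr
  -- The joint exponent differs from the sum of the marginal ones only by `-⟨r, v⟩ + σ² ⟨w, t⟩`; the
  -- normal equation `B Σ_Y = Aᵀ` makes this vanish.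
  have hcross : inner ℝ r v = σ ^ 2 * inner ℝ w t := by
    rw [hr, inner_sub_left, inner_toEuclideanLin, Matrix.transpose_transpose, hw,
      inner_toEuclideanLin, inner_toEuclideanLin, Matrix.transpose_transpose,
      ← inner_smul_right, ← inner_sub_right, ← eq_sub_iff_add_eq'.2 hcov]
  have hone : ∀ {n : ℕ} (x : EuclideanSpace ℝ (Fin n)),
      (1 : Matrix (Fin n) (Fin n) ℝ).toEuclideanLin x = x := by simp
  have hquad : inner ℝ t ((obsCov A σ).toEuclideanLin t) = inner ℝ v v + σ ^ 2 * inner ℝ t t := by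
    rw [obsCov, map_add, map_smul, LinearMap.add_apply, LinearMap.smul_apply, hone,
      toEuclideanLin_mul_apply, inner_add_right, inner_smul_right, hv,
      inner_toEuclideanLin, Matrix.transpose_transpose]
  have h1 : s + Aᵀ.toEuclideanLin (t - w) = r + v := by
    rw [map_sub, hr, hv]; abel
  have h2 : s + Aᵀ.toEuclideanLin (0 - w) = r := by
    rw [zero_sub, map_neg, hr]; abel
  rw [hG, hψ, hψ]
  dsimp only
  rw [← hw, h1, h2, charFun_centered_multivariateGaussian Matrix.PosSemidef.one,
    charFun_centered_multivariateGaussian Matrix.PosSemidef.one,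
    charFun_centered_multivariateGaussian (sq_smul_one_posSemidef σ),
    charFun_centered_multivariateGaussian (sq_smul_one_posSemidef σ),
    charFun_centered_multivariateGaussian (posSemidef_obsCov A σ),
    ← Complex.exp_add, ← Complex.exp_add, ← Complex.exp_add, hquad]
  congr 1
  norm_cast
  simp only [map_smul, LinearMap.smul_apply, hone, inner_add_left, inner_add_right, inner_sub_left,
    inner_sub_right, inner_smul_right, zero_sub, inner_neg_left, inner_neg_right, neg_neg,
    real_inner_comm r v, real_inner_comm w t, hcross]
  ring

/-- This is where the Markov property enters: the kernel sees only `Y`, so independence of `X - B Y`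
from `Y` extends to the pair `(Y, Ŷ)`. -/
lemma map_jointLaw (A : Matrix (Fin L) (Fin M) ℝ) (σ : ℝ) {B : Matrix (Fin M) (Fin L) ℝ}
    (hB : B * obsCov A σ = Aᵀ)
    (κ : Kernel (EuclideanSpace ℝ (Fin L)) (EuclideanSpace ℝ (Fin L))) [IsMarkovKernel κ] :
    (jointLaw A σ κ).map (fun p => (p.1.1 - B.toEuclideanLin p.1.2, p.1.2, p.2)) =
      ((sourceObsLaw A σ).map fun q => q.1 - B.toEuclideanLin q.2).prod (obsRecLaw A σ κ) := by
  refine Measure.ext_of_lintegral _ fun f hf => ?_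
  rw [lintegral_map hf (by fun_prop), lintegral_jointLaw _ _ _ (by fun_prop),
    lintegral_prod _ (by fun_prop)]
  simp_rw [obsRecLaw_eq_compProd]
  have : ∀ g, ∫⁻ y, f (g, y) ∂(multivariateGaussian 0 (obsCov A σ) ⊗ₘ κ) =
      ∫⁻ y, ∫⁻ z, f (g, y, z) ∂(κ y) ∂(multivariateGaussian 0 (obsCov A σ)) := fun g =>
    Measure.lintegral_compProd (by fun_prop)
  simp_rw [this]
  have hm : Measurable fun q : EuclideanSpace ℝ (Fin M) × EuclideanSpace ℝ (Fin L) =>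
      ∫⁻ z, f (q.1, q.2, z) ∂(κ q.2) := by
    have : Measurable fun r : (EuclideanSpace ℝ (Fin M) × EuclideanSpace ℝ (Fin L)) ×
        EuclideanSpace ℝ (Fin L) => f (r.1.1, r.1.2, r.2) := by fun_prop
    exact this.lintegral_kernel_prod_right' (κ := κ.comap Prod.snd measurable_snd)
  rw [← lintegral_prod (fun q : EuclideanSpace ℝ (Fin M) × EuclideanSpace ℝ (Fin L) =>
      ∫⁻ z, f (q.1, q.2, z) ∂(κ q.2)) hm.aemeasurable, ← map_sub_sourceObsLaw A σ hB,
    lintegral_map hm (by fun_prop)]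

end SourceLaw

/-! ### Mutual information of an additive Gaussian channel. -/

section MutualInformation

variable {L : ℕ}

section AdditiveNoise

variable {E : Type*} [NormedAddCommGroup E] [InnerProductSpace ℝ E] [FiniteDimensional ℝ E]
  [MeasurableSpace E] [BorelSpace E]

/-- Translation invariance of Lebesgue measure turns the noise variable into `y - z`. The input law
`P` needs no density, which matters because `Ŷ` is degenerate in the inactive directions. -/
lemma map_add_prod_eq_withDensity {g h : E → ℝ≥0∞} (hg : Measurable g) (hh : Measurable h)
    (hg0 : ∀ x, g x ≠ 0) (hgt : ∀ x, g x ≠ ⊤) (P : Measure E) [IsProbabilityMeasure P]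
    [IsProbabilityMeasure (volume.withDensity h)] [IsProbabilityMeasure (volume.withDensity g)] :
    (P.prod (volume.withDensity h)).map (fun p => (p.1 + p.2, p.1)) =
      ((volume.withDensity g).prod P).withDensity (fun q => h (q.1 - q.2) / g q.1) := by
  refine Measure.ext_of_lintegral _ fun f hf => ?_
  rw [lintegral_map hf (by fun_prop), lintegral_prod _ (by fun_prop),
    lintegral_withDensity_eq_lintegral_mul _ (by fun_prop) hf, lintegral_prod_symm _ (by fun_prop)]
  refine lintegral_congr fun z => ?_
  rw [lintegral_withDensity_eq_lintegral_mul _ hh (by fun_prop),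
    lintegral_withDensity_eq_lintegral_mul _ hg (by fun_prop),
    ← lintegral_sub_right_eq_self _ z]
  refine lintegral_congr fun y => ?_
  simp only [Pi.mul_apply, add_sub_cancel]
  rw [← mul_assoc, ENNReal.mul_div_cancel (hg0 y) (hgt y)]

/-- The log-likelihood ratio splits as `log h(y - z) - log g(y)`. The first term sees only the noise
and the second only the output, so each is integrated against its own law. -/
lemma klDiv_additive_noise {g h : E → ℝ} (hg : Measurable g) (hh : Measurable h)
    (hg0 : ∀ x, 0 < g x) (hh0 : ∀ x, 0 < h x) (P : Measure E) [IsProbabilityMeasure P]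
    {N G : Measure E} [IsProbabilityMeasure N] [IsProbabilityMeasure G]
    (hN : N = volume.withDensity fun x => ENNReal.ofReal (h x))
    (hG : G = volume.withDensity fun x => ENNReal.ofReal (g x))
    (hlogh : Integrable (fun x => Real.log (h x)) N)
    (hlogg : Integrable (fun x => Real.log (g x)) G)
    {ρ : Measure (E × E)} (hρ : ρ = (P.prod N).map (fun p => (p.1 + p.2, p.1)))
    (hfst : ρ.fst = G) :
    klDiv ρ (ρ.fst.prod ρ.snd) =
      ENNReal.ofReal (∫ x, Real.log (h x) ∂N - ∫ x, Real.log (g x) ∂G) := by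
  have : IsProbabilityMeasure ρ := by
    rw [hρ]; exact Measure.isProbabilityMeasure_map (by fun_prop)
  have hsnd : ρ.snd = P := by
    rw [hρ, Measure.snd, Measure.map_map (by fun_prop) (by fun_prop)]
    change Measure.map Prod.fst _ = _
    rw [Measure.map_fst_prod]
    simp
  have hdens : ρ = (G.prod P).withDensity
      (fun q => ENNReal.ofReal (h (q.1 - q.2)) / ENNReal.ofReal (g q.1)) := by
    subst hN hG
    rw [hρ]
    exact map_add_prod_eq_withDensity (g := fun x => ENNReal.ofReal (g x))
      (h := fun x => ENNReal.ofReal (h x)) (by fun_prop) (by fun_prop)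
      (fun x => by simpa using hg0 x) (by simp) P
  have hac : ρ ≪ G.prod P := by
    rw [hdens]; exact withDensity_absolutelyContinuous _ _
  have hllr : llr ρ (G.prod P) =ᵐ[ρ]
      fun q => Real.log (h (q.1 - q.2)) - Real.log (g q.1) := by
    have h1 : ρ.rnDeriv (G.prod P) =ᵐ[G.prod P]
        fun q => ENNReal.ofReal (h (q.1 - q.2)) / ENNReal.ofReal (g q.1) := by
      conv_lhs => rw [hdens]
      exact Measure.rnDeriv_withDensity _ (by fun_prop)
    filter_upwards [hac.ae_le h1] with q hq
    rw [llr_def]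
    simp only [hq, ENNReal.toReal_div]
    rw [ENNReal.toReal_ofReal (hh0 _).le, ENNReal.toReal_ofReal (hg0 _).le,
      Real.log_div (hh0 _).ne' (hg0 _).ne']
  have hsub : ρ.map (fun q => q.1 - q.2) = N := by
    rw [hρ, Measure.map_map (by fun_prop) (by fun_prop)]
    have : ((fun q : E × E => q.1 - q.2) ∘ fun p : E × E => (p.1 + p.2, p.1)) = Prod.snd := by
      ext p; simp
    rw [this, Measure.map_snd_prod]
    simp
  have hi1 : Integrable (fun q : E × E => Real.log (h (q.1 - q.2))) ρ :=
    (hsub ▸ hlogh).comp_measurable (g := fun x => Real.log (h x)) (by fun_prop)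
  have hi2 : Integrable (fun q : E × E => Real.log (g q.1)) ρ :=
    Integrable.comp_measurable (g := fun x => Real.log (g x))
      (show Integrable _ ρ.fst by rwa [hfst]) measurable_fst
  rw [hfst, hsnd, klDiv_of_ac_of_integrable hac ((hi1.sub hi2).congr hllr.symm),
    integral_congr_ae hllr, integral_sub hi1 hi2]
  congr 1
  have e1 : ∫ q, Real.log (h (q.1 - q.2)) ∂ρ = ∫ x, Real.log (h x) ∂N := by
    rw [← hsub, integral_map (by fun_prop) hh.log.aestronglyMeasurable]
  have e2 : ∫ q, Real.log (g q.1) ∂ρ = ∫ x, Real.log (g x) ∂G := by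
    rw [← hfst, Measure.fst, integral_map (by fun_prop) hg.log.aestronglyMeasurable]
  simp [e1, e2]

end AdditiveNoise

/-- The density of `N(0, U diag(d) Uᵀ)` for an orthogonal matrix `U`. -/
def rotatedGaussianPDF (U : Matrix (Fin L) (Fin L) ℝ) (d : Fin L → ℝ)
    (y : EuclideanSpace ℝ (Fin L)) : ℝ :=
  ∏ i, gaussianPDFReal 0 (d i).toNNReal (Uᵀ.toEuclideanLin y i)

lemma pi_gaussianReal_eq_withDensity {d : Fin L → ℝ} (hd : ∀ i, 0 < d i) :
    Measure.pi (fun i => gaussianReal 0 (d i).toNNReal) =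
      volume.withDensity fun x : Fin L → ℝ =>
        ENNReal.ofReal (∏ i, gaussianPDFReal 0 (d i).toNNReal (x i)) := by
  refine Measure.pi_eq fun s hs => ?_
  have hi : ∀ i, Integrable ((s i).indicator (gaussianPDFReal 0 (d i).toNNReal)) :=
    fun i => (integrable_gaussianPDFReal _ _).indicator (hs i)
  have h0 : ∀ i x, 0 ≤ (s i).indicator (gaussianPDFReal 0 (d i).toNNReal) x :=
    fun i x => Set.indicator_nonneg (fun x _ => gaussianPDFReal_nonneg _ _ _) x
  rw [withDensity_apply _ (MeasurableSet.univ_pi hs),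
    ← lintegral_indicator (MeasurableSet.univ_pi hs)]
  have h1 : ∀ x : Fin L → ℝ, (Set.univ.pi s).indicator
      (fun x => ENNReal.ofReal (∏ i, gaussianPDFReal 0 (d i).toNNReal (x i))) x =
      ENNReal.ofReal (∏ i, (s i).indicator (gaussianPDFReal 0 (d i).toNNReal) (x i)) := by
    intro x
    by_cases hx : x ∈ Set.univ.pi s
    · rw [Set.indicator_of_mem hx]
      congr 1
      exact Finset.prod_congr rfl fun i _ => by rw [Set.indicator_of_mem (hx i trivial)]
    · rw [Set.indicator_of_notMem hx]
      simp only [Set.mem_univ_pi, not_forall] at hx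
      obtain ⟨i, hi⟩ := hx
      rw [Finset.prod_eq_zero (Finset.mem_univ i) (Set.indicator_of_notMem hi _)]
      simp
  simp_rw [h1]
  rw [volume_pi, ← ofReal_integral_eq_lintegral_ofReal (Integrable.fintype_prod hi)
      (ae_of_all _ fun x => Finset.prod_nonneg fun i _ => h0 i _),
    integral_fintype_prod_eq_prod, ENNReal.ofReal_prod_of_nonneg
      fun i _ => integral_nonneg (h0 i)]
  refine Finset.prod_congr rfl fun i _ => ?_
  rw [gaussianReal_apply_eq_integral _ (by simpa using hd i), integral_indicator (hs i)]

/-- The linear isometric equivalence of an orthogonal matrix. -/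
def rotation (U : Matrix (Fin L) (Fin L) ℝ) (hU : U ∈ Matrix.orthogonalGroup (Fin L) ℝ) :
    EuclideanSpace ℝ (Fin L) ≃ₗᵢ[ℝ] EuclideanSpace ℝ (Fin L) where
  toLinearEquiv := LinearEquiv.ofLinearMap U.toEuclideanLin Uᵀ.toEuclideanLin
    (by
      ext1 x
      rw [LinearMap.comp_apply, ← toEuclideanLin_mul_apply,
        self_mul_transpose_of_mem_orthogonalGroup hU]
      simp)
    (by
      ext1 x
      rw [LinearMap.comp_apply, ← toEuclideanLin_mul_apply,
        transpose_mul_self_of_mem_orthogonalGroup hU]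
      simp)
  norm_map' x := by
    change ‖U.toEuclideanLin x‖ = ‖x‖
    rw [norm_eq_sqrt_real_inner, norm_eq_sqrt_real_inner, inner_toEuclideanLin,
      ← toEuclideanLin_mul_apply, transpose_mul_self_of_mem_orthogonalGroup hU]
    simp

lemma rotatedGaussianPDF_pos (U : Matrix (Fin L) (Fin L) ℝ) {d : Fin L → ℝ} (hd : ∀ i, 0 < d i)
    (y : EuclideanSpace ℝ (Fin L)) : 0 < rotatedGaussianPDF U d y :=
  Finset.prod_pos fun i _ => gaussianPDFReal_pos _ _ _ (by simpa using hd i)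

@[fun_prop]
lemma measurable_rotatedGaussianPDF (U : Matrix (Fin L) (Fin L) ℝ) (d : Fin L → ℝ) :
    Measurable (rotatedGaussianPDF U d) := by
  unfold rotatedGaussianPDF
  fun_prop

/-- An orthogonal map preserves Lebesgue measure, so the product density is merely evaluated at `Uᵀ
y`. -/
lemma rotatedGaussian_eq_withDensity {U : Matrix (Fin L) (Fin L) ℝ}
    (hU : U ∈ Matrix.orthogonalGroup (Fin L) ℝ) {d : Fin L → ℝ} (hd : ∀ i, 0 < d i) :
    (multivariateGaussian 0 (Matrix.diagonal d)).map (fun x => U.toEuclideanLin x) =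
      volume.withDensity fun y => ENNReal.ofReal (rotatedGaussianPDF U d y) := by
  rw [multivariateGaussian_diagonal fun i => (hd i).le, Measure.map_map (by fun_prop) (by fun_prop),
    pi_gaussianReal_eq_withDensity hd]
  have hmp : MeasurePreserving (fun x : Fin L → ℝ => U.toEuclideanLin (WithLp.toLp 2 x)) :=
    (rotation U hU).measurePreserving.comp (PiLp.volume_preserving_toLp (Fin L))
  refine Measure.ext_of_lintegral _ fun f hf => ?_
  rw [lintegral_map hf (by fun_prop), lintegral_withDensity_eq_lintegral_mul _ (by fun_prop)
    (by fun_prop), lintegral_withDensity_eq_lintegral_mul _ (by fun_prop) hf, ← hmp.map_eq,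
    lintegral_map (by fun_prop) (by fun_prop)]
  refine lintegral_congr fun x => ?_
  simp only [Pi.mul_apply, rotatedGaussianPDF, ← toEuclideanLin_mul_apply,
    transpose_mul_self_of_mem_orthogonalGroup hU]
  simp

lemma log_gaussianPDFReal_zero {v : ℝ} (hv : 0 < v) (x : ℝ) :
    Real.log (gaussianPDFReal 0 v.toNNReal x) =
      -(Real.log (2 * Real.pi * v) / 2) - x ^ 2 / (2 * v) := by
  rw [gaussianPDFReal, Real.log_mul (by positivity) (by positivity), Real.log_inv, Real.log_exp,
    Real.log_sqrt (by positivity)]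
  simp [hv.le]
  ring

/-- The differential entropy of `N(0, U diag(d) Uᵀ)`, up to sign. -/
lemma integral_log_rotatedGaussianPDF {U : Matrix (Fin L) (Fin L) ℝ}
    (hU : U ∈ Matrix.orthogonalGroup (Fin L) ℝ) {d : Fin L → ℝ} (hd : ∀ i, 0 < d i) :
    Integrable (fun y => Real.log (rotatedGaussianPDF U d y))
      ((multivariateGaussian 0 (Matrix.diagonal d)).map fun x => U.toEuclideanLin x) ∧
    ∫ y, Real.log (rotatedGaussianPDF U d y)
      ∂((multivariateGaussian 0 (Matrix.diagonal d)).map fun x => U.toEuclideanLin x) =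
      ∑ i, (-(Real.log (2 * Real.pi * d i) / 2) - 1 / 2) := by
  have hlog : ∀ x, Real.log (rotatedGaussianPDF U d (U.toEuclideanLin x)) =
      ∑ i, (-(Real.log (2 * Real.pi * d i) / 2) - x i ^ 2 / (2 * d i)) := by
    intro x
    rw [rotatedGaussianPDF, Real.log_prod
      (fun i _ => (gaussianPDFReal_pos _ _ _ (by simpa using hd i)).ne')]
    simp_rw [log_gaussianPDFReal_zero (hd _), ← toEuclideanLin_mul_apply,
      transpose_mul_self_of_mem_orthogonalGroup hU]
    simp
  have hi : ∀ i, Integrable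
      (fun x : EuclideanSpace ℝ (Fin L) =>
        -(Real.log (2 * Real.pi * d i) / 2) - x i ^ 2 / (2 * d i))
      (multivariateGaussian 0 (Matrix.diagonal d)) := fun i =>
    (integrable_const _).sub ((integrable_coord_sq_multivariateGaussian _ i).div_const _)
  have hm := (measurable_rotatedGaussianPDF U d).log
  rw [integrable_map_measure hm.aestronglyMeasurable (by fun_prop),
    integral_map (by fun_prop) hm.aestronglyMeasurable]
  simp_rw [Function.comp_def, hlog]
  refine ⟨integrable_finsetSum _ fun i _ => hi i, ?_⟩
  rw [integral_finsetSum _ fun i _ => hi i]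
  refine Finset.sum_congr rfl fun i _ => ?_
  rw [integral_sub (integrable_const _)
      ((integrable_coord_sq_multivariateGaussian _ i).div_const _), integral_div,
    integral_coord_sq_multivariateGaussian (Matrix.PosSemidef.diagonal fun i => (hd i).le)]
  have := (hd i).ne'
  simp
  field_simp

/-- The mutual information across a backward Gaussian channel. -/
lemma mutualInfoBits_backward_channel {U : Matrix (Fin L) (Fin L) ℝ}
    (hU : U ∈ Matrix.orthogonalGroup (Fin L) ℝ) {D μ : Fin L → ℝ} (hD : ∀ i, 0 < D i)
    (hμ : ∀ i, 0 < μ i) (P : Measure (EuclideanSpace ℝ (Fin L))) [IsProbabilityMeasure P]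
    {ρ : Measure (EuclideanSpace ℝ (Fin L) × EuclideanSpace ℝ (Fin L))}
    (hρ : ρ = (P.prod (multivariateGaussian 0 (Matrix.diagonal D))).map
      (fun p => (p.1 + U.toEuclideanLin p.2, p.1)))
    (hfst : ρ.fst = multivariateGaussian 0 (U * Matrix.diagonal μ * Uᵀ)) :
    mutualInfoBits ρ = ENNReal.ofReal (1 / 2 * ∑ i, Real.logb 2 (μ i / D i)) := by
  have : IsProbabilityMeasure
      ((multivariateGaussian 0 (Matrix.diagonal D)).map fun x => U.toEuclideanLin x) :=
    Measure.isProbabilityMeasure_map (by fun_prop)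
  have hρ' : ρ = (P.prod ((multivariateGaussian 0 (Matrix.diagonal D)).map
      fun x => U.toEuclideanLin x)).map (fun p => (p.1 + p.2, p.1)) := by
    rw [hρ]
    conv_rhs => rw [← Measure.map_id (μ := P), Measure.map_prod_map _ _ measurable_id
      (by fun_prop), Measure.map_map (by fun_prop) (by fun_prop)]
    rfl
  have hG : multivariateGaussian 0 (U * Matrix.diagonal μ * Uᵀ) =
      (multivariateGaussian 0 (Matrix.diagonal μ)).map fun x => U.toEuclideanLin x :=
    (map_toEuclideanLin_multivariateGaussian _
      (Matrix.PosSemidef.diagonal fun i => (hμ i).le)).symm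
  have h := klDiv_additive_noise (measurable_rotatedGaussianPDF U μ)
    (measurable_rotatedGaussianPDF U D) (rotatedGaussianPDF_pos U hμ)
    (rotatedGaussianPDF_pos U hD) P (rotatedGaussian_eq_withDensity hU hD)
    (hG.trans (rotatedGaussian_eq_withDensity hU hμ)) (integral_log_rotatedGaussianPDF hU hD).1
    (hG ▸ (integral_log_rotatedGaussianPDF hU hμ).1) hρ' hfst
  rw [mutualInfoBits, h, hG, (integral_log_rotatedGaussianPDF hU hD).2,
    (integral_log_rotatedGaussianPDF hU hμ).2,
    ← ENNReal.ofReal_div_of_pos (Real.log_pos one_lt_two)]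
  congr 1
  -- The entropy constants `log 2π` and `1/2` cancel componentwise, leaving `½ log (μ i / D i)`.
  rw [← Finset.sum_sub_distrib, Finset.sum_div, Finset.mul_sum]
  refine Finset.sum_congr rfl fun i _ => ?_
  have h1 := hD i
  have h2 := hμ i
  rw [Real.logb, Real.log_div h2.ne' h1.ne', Real.log_mul (by positivity) h1.ne',
    Real.log_mul (by positivity) h2.ne']
  ring

end MutualInformation

/-! ### Reverse water-filling: the rate equation and its unique solution. -/

section WaterFilling

variable {L : ℕ}

lemma sum_fin_succ_eq_sum_Icc {β : Type*} [AddCommMonoid β] (f : ℕ → β) :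
    ∑ i : Fin L, f (i + 1) = ∑ l ∈ Finset.Icc 1 L, f l := by
  rw [Fin.sum_univ_eq_sum_range (fun i => f (i + 1)), Finset.range_eq_Ico,
    Finset.sum_Ico_add' f 0 L 1]
  rfl

/-- The rate, in bits, of reverse water-filling at level `θ` over the variances `m 1, …, m L`. -/
def waterFillingRate (L : ℕ) (m : ℕ → ℝ) (θ : ℝ) : ℝ :=
  1 / 2 * ∑ l ∈ Finset.Icc 1 L, Real.logb 2 (m l / min (m l) θ)

/-- No term increases with the level, and the first one decreases strictly because `θ < m 1`. Some
such condition is needed: above all the variances the rate is constantly zero. -/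
lemma waterFillingRate_strictAnti {m : ℕ → ℝ} (hL : 1 ≤ L) (hm : ∀ l ∈ Finset.Icc 1 L, 0 < m l)
    {θ θ' : ℝ} (hθ : 0 < θ) (hlt : θ < θ') (h1 : θ < m 1) :
    waterFillingRate L m θ' < waterFillingRate L m θ := by
  have hθ' := hθ.trans hlt
  have h : ∑ l ∈ Finset.Icc 1 L, Real.logb 2 (m l / min (m l) θ') <
      ∑ l ∈ Finset.Icc 1 L, Real.logb 2 (m l / min (m l) θ) := by
    refine Finset.sum_lt_sum (fun l hl => ?_) ⟨1, by simpa using hL, ?_⟩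
    · have := hm l hl
      have h2 : 0 < min (m l) θ := lt_min this hθ
      have h3 : 0 < min (m l) θ' := lt_min this hθ'
      refine Real.logb_le_logb_of_le one_lt_two (by positivity) ?_
      gcongr
    · have := hm 1 (by simpa using hL)
      have h3 : 0 < min (m 1) θ' := lt_min this hθ'
      rw [min_eq_right h1.le]
      refine Real.logb_lt_logb one_lt_two (by positivity) ?_
      gcongr
      exact lt_min h1 hlt
  unfold waterFillingRate
  linarith

/-- The solution of the water-filling equation when exactly the first `k` components are active. -/
def activeLevel (m : ℕ → ℝ) (k : ℕ) (R : ℝ) : ℝ :=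
  (2 : ℝ) ^ (-(2 * R) / (k : ℝ)) * (∏ l ∈ Finset.Icc 1 k, m l) ^ (1 / (k : ℝ))

section

variable {m : ℕ → ℝ} {k : ℕ} {R : ℝ}

lemma activeLevel_pos (hm : ∀ l ∈ Finset.Icc 1 k, 0 < m l) : 0 < activeLevel m k R := by
  have : 0 < ∏ l ∈ Finset.Icc 1 k, m l := Finset.prod_pos hm
  unfold activeLevel
  positivity

lemma mul_logb_activeLevel (hk : 1 ≤ k) (hm : ∀ l ∈ Finset.Icc 1 k, 0 < m l) :
    k * Real.logb 2 (activeLevel m k R) = -(2 * R) + ∑ l ∈ Finset.Icc 1 k, Real.logb 2 (m l) := by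
  have hp : 0 < ∏ l ∈ Finset.Icc 1 k, m l := Finset.prod_pos hm
  have hk' : (k : ℝ) ≠ 0 := by positivity
  rw [activeLevel, Real.logb_mul (by positivity) (by positivity),
    Real.logb_rpow two_pos (by norm_num), Real.logb_rpow_eq_mul_logb_of_pos hp,
    Real.logb_prod _ _ fun l hl => (hm l hl).ne']
  field_simp

lemma sum_logb_div (hm : ∀ l ∈ Finset.Icc 1 k, 0 < m l) {c : ℝ} (hc : 0 < c) :
    ∑ l ∈ Finset.Icc 1 k, Real.logb 2 (m l / c) =
      ∑ l ∈ Finset.Icc 1 k, Real.logb 2 (m l) - k * Real.logb 2 c := by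
  rw [Finset.sum_congr rfl fun l hl => Real.logb_div (hm l hl).ne' hc.ne']
  simp

/-- By `mul_logb_activeLevel` the rate bound is the claim in logarithmic form, multiplied by `k`. -/
lemma activeLevel_lt (hk : 1 ≤ k) (hm : ∀ l ∈ Finset.Icc 1 k, 0 < m l)
    (hR : 1 / 2 * ∑ l ∈ Finset.Icc 1 k, Real.logb 2 (m l / m k) < R) :
    activeLevel m k R < m k := by
  have hmk := hm k (by simpa using hk)
  rw [sum_logb_div hm hmk] at hR
  have h := mul_logb_activeLevel (R := R) hk hm
  rw [← Real.logb_lt_logb_iff one_lt_two (activeLevel_pos hm) hmk]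
  refine lt_of_mul_lt_mul_left (a := (k : ℝ)) ?_ (by positivity)
  linarith

/-- The term `l = k + 1` of the threshold is `log₂ 1 = 0`, so the bound really involves `k` terms
and compares with the `k`-component level. -/
lemma le_activeLevel (hk : 1 ≤ k) (hm : ∀ l ∈ Finset.Icc 1 (k + 1), 0 < m l)
    (hR : R ≤ 1 / 2 * ∑ l ∈ Finset.Icc 1 (k + 1), Real.logb 2 (m l / m (k + 1))) :
    m (k + 1) ≤ activeLevel m k R := by
  have hmk := hm (k + 1) (by simp)
  have hm' : ∀ l ∈ Finset.Icc 1 k, 0 < m l :=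
    fun l hl => hm l (Finset.Icc_subset_Icc_right k.le_succ hl)
  rw [sum_logb_div hm hmk, Finset.sum_Icc_succ_top (by omega)] at hR
  have h := mul_logb_activeLevel (R := R) hk hm'
  rw [← Real.logb_le_logb one_lt_two hmk (activeLevel_pos hm')]
  refine le_of_mul_le_mul_left (a := (k : ℝ)) ?_ (by positivity)
  push_cast at hR
  linarith

/-- Stated for a general `f` so that it splits both the rate and the distortion into active and
inactive components. -/
lemma sum_Icc_min_eq {θ : ℝ} (hkL : k ≤ L) (hle : ∀ l ∈ Finset.Icc 1 k, θ ≤ m l)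
    (hge : ∀ l ∈ Finset.Icc (k + 1) L, m l ≤ θ) (f : ℕ → ℝ → ℝ) :
    ∑ l ∈ Finset.Icc 1 L, f l (min (m l) θ) =
      ∑ l ∈ Finset.Icc 1 k, f l θ + ∑ l ∈ Finset.Icc (k + 1) L, f l (m l) := by
  have hd : Disjoint (Finset.Icc 1 k) (Finset.Icc (k + 1) L) := by
    rw [Finset.disjoint_left]
    intro l h1 h2
    simp only [Finset.mem_Icc] at h1 h2
    omega
  have hu : Finset.Icc 1 L = Finset.Icc 1 k ∪ Finset.Icc (k + 1) L := by
    ext l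
    simp only [Finset.mem_union, Finset.mem_Icc]
    omega
  rw [hu, Finset.sum_union hd]
  congr 1
  · exact Finset.sum_congr rfl fun l hl => by rw [min_eq_right (hle l hl)]
  · exact Finset.sum_congr rfl fun l hl => by rw [min_eq_left (hge l hl)]

lemma waterFillingRate_activeLevel (hk : 1 ≤ k) (hkL : k ≤ L)
    (hm : ∀ l ∈ Finset.Icc 1 L, 0 < m l)
    (hle : ∀ l ∈ Finset.Icc 1 k, activeLevel m k R ≤ m l)
    (hge : ∀ l ∈ Finset.Icc (k + 1) L, m l ≤ activeLevel m k R) :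
    waterFillingRate L m (activeLevel m k R) = R := by
  have hm' : ∀ l ∈ Finset.Icc 1 k, 0 < m l :=
    fun l hl => hm l (Finset.Icc_subset_Icc_right hkL hl)
  have h0 : ∑ l ∈ Finset.Icc (k + 1) L, Real.logb 2 (m l / m l) = 0 := by
    refine Finset.sum_eq_zero fun l hl => ?_
    rw [div_self (hm l (Finset.Icc_subset_Icc_left (by omega) hl)).ne', Real.logb_one]
  rw [waterFillingRate, sum_Icc_min_eq hkL hle hge (fun l x => Real.logb 2 (m l / x)), h0,
    sum_logb_div hm' (activeLevel_pos hm'), mul_logb_activeLevel hk hm']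
  ring

/-- Strict monotonicity is always applied from the smaller of the two levels, which lies below `m 1`
in either case; hence no upper bound on `θ` is required. -/
lemma eq_activeLevel_of_waterFillingRate_eq (hk : 1 ≤ k) (hkL : k ≤ L)
    (hm : ∀ l ∈ Finset.Icc 1 L, 0 < m l)
    (hlt : activeLevel m k R < m 1)
    (hrate : waterFillingRate L m (activeLevel m k R) = R) {θ : ℝ} (hθ : 0 < θ)
    (h : waterFillingRate L m θ = R) : θ = activeLevel m k R := by
  have hL : 1 ≤ L := hk.trans hkL
  rcases lt_trichotomy θ (activeLevel m k R) with h1 | h1 | h1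
  · have := waterFillingRate_strictAnti hL hm hθ h1 (h1.trans hlt)
    linarith
  · exact h1
  · have := waterFillingRate_strictAnti hL hm
      (activeLevel_pos fun l hl => hm l (Finset.Icc_subset_Icc_right hkL hl)) h1 hlt
    linarith

end

end WaterFilling

/-! ### The conditional mean given `Ŷ` and its mean square error. -/

section Distortion

variable {M L : ℕ}

lemma integral_norm_add_sq_prod {E : Type*} [NormedAddCommGroup E] [InnerProductSpace ℝ E]
    [FiniteDimensional ℝ E] [MeasurableSpace E] [BorelSpace E] {μ ν : Measure E}
    [IsProbabilityMeasure μ] [IsProbabilityMeasure ν] (hμ : MemLp id 2 μ) (hν : MemLp id 2 ν)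
    (h0 : ∫ y, y ∂ν = 0) :
    ∫ p, ‖p.1 + p.2‖ ^ 2 ∂(μ.prod ν) = ∫ x, ‖x‖ ^ 2 ∂μ + ∫ y, ‖y‖ ^ 2 ∂ν := by
  have h1 : Integrable (fun x => ‖x‖ ^ 2) μ := hμ.integrable_norm_pow (by norm_num)
  have h2 : Integrable (fun x => ‖x‖ ^ 2) ν := hν.integrable_norm_pow (by norm_num)
  have hi1 : Integrable (fun x : E => x) μ := hμ.integrable (by norm_num)
  have hi2 : Integrable (fun x : E => x) ν := hν.integrable (by norm_num)
  have hin : Integrable (fun p : E × E => inner ℝ p.1 p.2) (μ.prod ν) :=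
    (hi1.norm.mul_prod hi2.norm).mono' (by fun_prop)
      (ae_of_all _ fun p => norm_inner_le_norm _ _)
  have hin0 : ∫ p : E × E, inner ℝ p.1 p.2 ∂(μ.prod ν) = 0 := by
    rw [integral_prod _ hin]
    simp [integral_inner hi2, h0]
  simp_rw [norm_add_sq_real]
  have hsum : Integrable (fun p : E × E => ‖p.1‖ ^ 2 + 2 * inner ℝ p.1 p.2) (μ.prod ν) :=
    (h1.comp_fst ν).add (hin.const_mul 2)
  rw [integral_add hsum (h2.comp_snd μ),
    integral_add (h1.comp_fst ν) (hin.const_mul 2), integral_const_mul, hin0,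
    integral_fun_fst (fun x => ‖x‖ ^ 2), integral_fun_snd (fun x => ‖x‖ ^ 2)]
  simp

/-- The law of the error `X - B Y` of the linear estimate `B Y` of `X`. -/
def linearErrorLaw (A : Matrix (Fin L) (Fin M) ℝ) (σ : ℝ) (B : Matrix (Fin M) (Fin L) ℝ) :
    Measure (EuclideanSpace ℝ (Fin M)) :=
  (sourceObsLaw A σ).map fun q => q.1 - B.toEuclideanLin q.2

instance (A : Matrix (Fin L) (Fin M) ℝ) (σ : ℝ) (B : Matrix (Fin M) (Fin L) ℝ) :
    IsProbabilityMeasure (linearErrorLaw A σ B) :=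
  Measure.isProbabilityMeasure_map (by fun_prop)

lemma memLp_fst_sourceObsLaw (A : Matrix (Fin L) (Fin M) ℝ) (σ : ℝ) :
    MemLp (fun q => q.1) 2 (sourceObsLaw A σ) := by
  have h : MemLp id 2 (sourceObsLaw A σ).fst := by
    rw [fst_sourceObsLaw]; exact IsGaussian.memLp_two_id
  exact h.comp_of_map (by fun_prop)

lemma memLp_map_toEuclideanLin (B : Matrix (Fin M) (Fin L) ℝ) (S : Matrix (Fin L) (Fin L) ℝ) :
    MemLp (fun y => B.toEuclideanLin y) 2 (multivariateGaussian 0 S) :=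
  (Matrix.toEuclideanLin B).toContinuousLinearMap.comp_memLp' IsGaussian.memLp_two_id

lemma memLp_snd_sourceObsLaw (A : Matrix (Fin L) (Fin M) ℝ) (σ : ℝ)
    (B : Matrix (Fin M) (Fin L) ℝ) :
    MemLp (fun q => B.toEuclideanLin q.2) 2 (sourceObsLaw A σ) := by
  have h : MemLp (fun y => B.toEuclideanLin y) 2 (sourceObsLaw A σ).snd := by
    rw [snd_sourceObsLaw]; exact memLp_map_toEuclideanLin _ _
  exact h.comp_of_map (by fun_prop)

lemma memLp_id_linearErrorLaw (A : Matrix (Fin L) (Fin M) ℝ) (σ : ℝ)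
    (B : Matrix (Fin M) (Fin L) ℝ) : MemLp id 2 (linearErrorLaw A σ B) := by
  rw [linearErrorLaw, memLp_map_measure_iff (by fun_prop) (by fun_prop)]
  exact (memLp_fst_sourceObsLaw A σ).sub (memLp_snd_sourceObsLaw A σ B)

lemma integral_toEuclideanLin_multivariateGaussian (B : Matrix (Fin M) (Fin L) ℝ)
    (S : Matrix (Fin L) (Fin L) ℝ) :
    ∫ y, B.toEuclideanLin y ∂(multivariateGaussian 0 S) = 0 := by
  have h := (Matrix.toEuclideanLin B).toContinuousLinearMap.integral_comp_comm
    (IsGaussian.integrable_id (μ := multivariateGaussian 0 S))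
  simpa using h

lemma integral_id_linearErrorLaw (A : Matrix (Fin L) (Fin M) ℝ) (σ : ℝ)
    (B : Matrix (Fin M) (Fin L) ℝ) : ∫ x, x ∂(linearErrorLaw A σ B) = 0 := by
  rw [linearErrorLaw, integral_map (by fun_prop) (by fun_prop),
    integral_sub ((memLp_fst_sourceObsLaw A σ).integrable (by norm_num))
      ((memLp_snd_sourceObsLaw A σ B).integrable (by norm_num))]
  have h1 : ∫ q, q.1 ∂(sourceObsLaw A σ) = 0 := by
    rw [← integral_map (φ := Prod.fst) (f := fun x => x) (by fun_prop) (by fun_prop)]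
    change ∫ x, x ∂(sourceObsLaw A σ).fst = 0
    rw [fst_sourceObsLaw]
    simp
  have h2 : ∫ q, B.toEuclideanLin q.2 ∂(sourceObsLaw A σ) = 0 := by
    rw [← integral_map (φ := Prod.snd) (f := fun x => B.toEuclideanLin x) (by fun_prop)
      (by fun_prop)]
    change ∫ x, B.toEuclideanLin x ∂(sourceObsLaw A σ).snd = 0
    rw [snd_sourceObsLaw, integral_toEuclideanLin_multivariateGaussian]
  rw [h1, h2, sub_zero]

/-- The second moment of `e + B z` for independent `e` and `z ∼ N(0, S)`. -/
lemma integral_norm_add_toEuclideanLin_sq {μ : Measure (EuclideanSpace ℝ (Fin M))}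
    [IsProbabilityMeasure μ] (hμ : MemLp id 2 μ) (B : Matrix (Fin M) (Fin L) ℝ)
    {S : Matrix (Fin L) (Fin L) ℝ} (hS : S.PosSemidef) :
    ∫ p, ‖p.1 + B.toEuclideanLin p.2‖ ^ 2 ∂(μ.prod (multivariateGaussian 0 S)) =
      ∫ x, ‖x‖ ^ 2 ∂μ + (B * S * Bᵀ).trace := by
  have h := integral_norm_add_sq_prod (ν := multivariateGaussian 0 (B * S * Bᵀ)) hμ
    IsGaussian.memLp_two_id (by simp)
  rw [integral_norm_sq_multivariateGaussian (by simpa using hS.mul_mul_conjTranspose_same B),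
    ← map_toEuclideanLin_multivariateGaussian B hS] at h
  rw [← h]
  conv_rhs => rw [← Measure.map_id (μ := μ), Measure.map_prod_map _ _ measurable_id (by fun_prop),
    integral_map (by fun_prop) (by fun_prop)]
  rfl

/-- Pythagoras for `X = (X - B Y) + B Y` with independent summands, where `E‖X‖² = M`. -/
lemma integral_norm_sq_linearErrorLaw (A : Matrix (Fin L) (Fin M) ℝ) (σ : ℝ)
    {B : Matrix (Fin M) (Fin L) ℝ} (hB : B * obsCov A σ = Aᵀ) :
    ∫ x, ‖x‖ ^ 2 ∂(linearErrorLaw A σ B) = M - (B * obsCov A σ * Bᵀ).trace := by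
  have h := integral_norm_add_toEuclideanLin_sq (memLp_id_linearErrorLaw A σ B) B
    (posSemidef_obsCov A σ)
  rw [linearErrorLaw, ← map_sub_sourceObsLaw A σ hB, integral_map (by fun_prop) (by fun_prop)] at h
  simp only [sub_add_cancel] at h
  have h2 : ∫ q, ‖q.1‖ ^ 2 ∂(sourceObsLaw A σ) = M := by
    rw [← integral_map (φ := Prod.fst) (f := fun x => ‖x‖ ^ 2) (by fun_prop) (by fun_prop)]
    change ∫ x, ‖x‖ ^ 2 ∂(sourceObsLaw A σ).fst = M
    rw [fst_sourceObsLaw, integral_norm_sq_multivariateGaussian Matrix.PosSemidef.one]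
    simp
  rw [linearErrorLaw]
  linarith

/-- Under a backward channel `Y = Ŷ + U Z`, the error `X - B Ŷ` is independent of `Ŷ`. -/
lemma map_error_jointLaw (A : Matrix (Fin L) (Fin M) ℝ) (σ : ℝ) {B : Matrix (Fin M) (Fin L) ℝ}
    (hB : B * obsCov A σ = Aᵀ)
    (κ : Kernel (EuclideanSpace ℝ (Fin L)) (EuclideanSpace ℝ (Fin L))) [IsMarkovKernel κ]
    {U S : Matrix (Fin L) (Fin L) ℝ} {P : Measure (EuclideanSpace ℝ (Fin L))}
    [IsProbabilityMeasure P]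
    (h : obsRecLaw A σ κ = (P.prod (multivariateGaussian 0 S)).map
      (fun p => (p.1 + U.toEuclideanLin p.2, p.1))) :
    (jointLaw A σ κ).map (fun p => (p.1.1 - B.toEuclideanLin p.2, p.2)) =
      (((linearErrorLaw A σ B).prod (multivariateGaussian 0 S)).map
        fun p => p.1 + (B * U).toEuclideanLin p.2).prod P := by
  -- Here `X - B Ŷ` is written as `(X - B Y) + B (Y - Ŷ)`; the backward channel then replaces `Y -
  -- Ŷ` by `U Z`.
  have h1 : (jointLaw A σ κ).map (fun p => (p.1.1 - B.toEuclideanLin p.2, p.2)) =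
      ((linearErrorLaw A σ B).prod (obsRecLaw A σ κ)).map
        (fun p => (p.1 + B.toEuclideanLin (p.2.1 - p.2.2), p.2.2)) := by
    rw [linearErrorLaw, ← map_jointLaw A σ hB, Measure.map_map (by fun_prop) (by fun_prop)]
    congr 1
    ext1 p
    simp [map_sub]
  rw [h1, h]
  refine Measure.ext_of_lintegral _ fun f hf => ?_
  have : IsProbabilityMeasure ((P.prod (multivariateGaussian 0 S)).map
      (fun p => (p.1 + U.toEuclideanLin p.2, p.1))) :=
    Measure.isProbabilityMeasure_map (by fun_prop)
  have : IsProbabilityMeasure (((linearErrorLaw A σ B).prod (multivariateGaussian 0 S)).map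
        fun p => p.1 + (B * U).toEuclideanLin p.2) :=
    Measure.isProbabilityMeasure_map (by fun_prop)
  rw [lintegral_map hf (by fun_prop), lintegral_prod _ (by fun_prop), lintegral_prod _ (by fun_prop),
    lintegral_map (by fun_prop) (by fun_prop), lintegral_prod _ (by fun_prop)]
  refine lintegral_congr fun g => ?_
  rw [lintegral_map (by fun_prop) (by fun_prop), lintegral_prod_symm _ (by fun_prop)]
  simp

/-- The mean square error of estimating `X` from the output of a backward channel. -/
lemma ceDistortion_of_backward_channel (A : Matrix (Fin L) (Fin M) ℝ) (σ : ℝ)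
    {B : Matrix (Fin M) (Fin L) ℝ} (hB : B * obsCov A σ = Aᵀ)
    (κ : Kernel (EuclideanSpace ℝ (Fin L)) (EuclideanSpace ℝ (Fin L))) [IsMarkovKernel κ]
    {U S : Matrix (Fin L) (Fin L) ℝ} (hS : S.PosSemidef) {P : Measure (EuclideanSpace ℝ (Fin L))}
    [IsProbabilityMeasure P]
    (h : obsRecLaw A σ κ = (P.prod (multivariateGaussian 0 S)).map
      (fun p => (p.1 + U.toEuclideanLin p.2, p.1))) :
    ceDistortion A σ κ = 1 / (M : ℝ) * (M - (B * obsCov A σ * Bᵀ).trace +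
      (B * U * S * (B * U)ᵀ).trace) := by
  set J := jointLaw A σ κ with hJ
  have hmap := map_error_jointLaw A σ hB κ h
  set G := linearErrorLaw A σ B
  set N := multivariateGaussian 0 S
  set H := (G.prod N).map fun p => p.1 + (B * U).toEuclideanLin p.2 with hH
  have : IsProbabilityMeasure H := Measure.isProbabilityMeasure_map (by fun_prop)
  set e : (EuclideanSpace ℝ (Fin M) × EuclideanSpace ℝ (Fin L)) × EuclideanSpace ℝ (Fin L) →
    EuclideanSpace ℝ (Fin M) := fun p => p.1.1 - B.toEuclideanLin p.2 with he
  have hem : Measurable e := by fun_prop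
  have hmem : MemLp (fun p => p.1 + (B * U).toEuclideanLin p.2) 2 (G.prod N) :=
    (memLp_id_linearErrorLaw A σ B).comp_fst N |>.add
      ((memLp_map_toEuclideanLin (B * U) S).comp_snd G)
  have hlaw : J.map e = H := by
    have := congrArg Measure.fst hmap
    rwa [Measure.fst_prod, Measure.fst, Measure.map_map (by fun_prop) (by fun_prop)] at this
  have hlaw2 : J.map Prod.snd = P := by
    have := congrArg Measure.snd hmap
    rwa [Measure.snd_prod, Measure.snd, Measure.map_map (by fun_prop) (by fun_prop)] at this
  have hindep : IndepFun e Prod.snd J := by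
    rw [indepFun_iff_map_prod_eq_prod_map_map hem.aemeasurable (by fun_prop), hlaw, hlaw2]
    exact hmap
  have hei : Integrable e J := by
    have : Integrable (fun x => x) (J.map e) := by
      rw [hlaw, hH, integrable_map_measure (by fun_prop) (by fun_prop)]
      exact hmem.integrable (by norm_num)
    exact this.comp_measurable hem
  have he0 : ∫ p, e p ∂J = 0 := by
    have hi1 : Integrable (fun p => p.1) (G.prod N) :=
      ((memLp_id_linearErrorLaw A σ B).comp_fst N).integrable (by norm_num)
    have hi2 : Integrable (fun p => (B * U).toEuclideanLin p.2) (G.prod N) :=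
      ((memLp_map_toEuclideanLin (B * U) S).comp_snd G).integrable (by norm_num)
    rw [← integral_map (f := fun x => x) hem.aemeasurable (by fun_prop), hlaw, hH,
      integral_map (by fun_prop) (by fun_prop), integral_add hi1 hi2,
      integral_fun_snd (fun y => (B * U).toEuclideanLin y),
      integral_toEuclideanLin_multivariateGaussian,
      integral_fun_fst (fun x : EuclideanSpace ℝ (Fin M) => x), integral_id_linearErrorLaw]
    simp
  have hX : Integrable (fun p => p.1.1) J := by
    have h1 : Integrable (fun q => q.1) J.fst := by
      rw [hJ, jointLaw, Measure.fst_compProd]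
      exact (memLp_fst_sourceObsLaw A σ).integrable (by norm_num)
    exact h1.comp_measurable measurable_fst
  -- No moment of `P` is assumed; integrability of `B Ŷ` comes from `B Ŷ = X - e`.
  have hBi : Integrable (fun p => B.toEuclideanLin p.2) J := by
    refine (hX.sub hei).congr (ae_of_all _ fun p => ?_)
    simp [he]
  -- In `X = e + B Ŷ`, the first summand is independent of `Ŷ` with mean zero and the second is
  -- `Ŷ`-measurable.
  have hcond : J[fun q => q.1.1 | MeasurableSpace.comap Prod.snd inferInstance] =ᵐ[J]
      fun p => B.toEuclideanLin p.2 := by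
    have hle : MeasurableSpace.comap (Prod.snd : (EuclideanSpace ℝ (Fin M) ×
        EuclideanSpace ℝ (Fin L)) × EuclideanSpace ℝ (Fin L) → _) inferInstance ≤
        Prod.instMeasurableSpace :=
      measurable_snd.comap_le
    have hsm : StronglyMeasurable[MeasurableSpace.comap Prod.snd inferInstance]
        fun p : (EuclideanSpace ℝ (Fin M) × EuclideanSpace ℝ (Fin L)) ×
          EuclideanSpace ℝ (Fin L) => B.toEuclideanLin p.2 :=
      ((measurable_toEuclideanLin B).comp (comap_measurable _)).stronglyMeasurable
    have h1 := condExp_indep_eq (f := e) hem.comap_le hle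
      (comap_measurable e).stronglyMeasurable hindep
    have h2 := condExp_of_stronglyMeasurable hle hsm hBi
    have h3 : (fun q => q.1.1) = e + fun p => B.toEuclideanLin p.2 := by
      ext1 p; simp [he]
    rw [h3]
    filter_upwards [condExp_add hei hBi (MeasurableSpace.comap Prod.snd inferInstance), h1]
      with p hp hp1
    rw [hp, Pi.add_apply, hp1, h2, he0, zero_add]
  have hint : ∫ p, ‖e p‖ ^ 2 ∂J = M - (B * obsCov A σ * Bᵀ).trace +
      (B * U * S * (B * U)ᵀ).trace := by
    rw [← integral_map (f := fun x => ‖x‖ ^ 2) hem.aemeasurable (by fun_prop), hlaw, hH,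
      integral_map (by fun_prop) (by fun_prop),
      integral_norm_add_toEuclideanLin_sq (memLp_id_linearErrorLaw A σ B) (B * U) hS,
      integral_norm_sq_linearErrorLaw A σ hB]
  rw [ceDistortion, ← hint, ← hJ]
  congr 1
  refine integral_congr_ae ?_
  filter_upwards [hcond] with p hp
  rw [hp]

end Distortion

/-! ### The Wiener matrix in the eigenbasis, and construction of the test channel. -/

section TestChannel

variable {M L : ℕ}

lemma eq_conj_diagonal {U C : Matrix (Fin L) (Fin L) ℝ}
    (hU : U ∈ Matrix.orthogonalGroup (Fin L) ℝ) {d : Fin L → ℝ}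
    (h : Uᵀ * C * U = Matrix.diagonal d) : C = U * Matrix.diagonal d * Uᵀ := by
  have h1 := self_mul_transpose_of_mem_orthogonalGroup hU
  rw [← h]
  calc C = (U * Uᵀ) * C * (U * Uᵀ) := by rw [h1, Matrix.one_mul, Matrix.mul_one]
    _ = _ := by simp only [Matrix.mul_assoc]

/-- The matrix of the linear minimum mean square error estimator of `X` from `Y`. -/
def wienerMatrix (A : Matrix (Fin L) (Fin M) ℝ) (U : Matrix (Fin L) (Fin L) ℝ) (μ : Fin L → ℝ) :
    Matrix (Fin M) (Fin L) ℝ :=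
  Aᵀ * U * Matrix.diagonal (fun i => (μ i)⁻¹) * Uᵀ

section

variable {A : Matrix (Fin L) (Fin M) ℝ} {σ : ℝ} {U : Matrix (Fin L) (Fin L) ℝ} {μ : Fin L → ℝ}

lemma wienerMatrix_mul_obsCov (hU : U ∈ Matrix.orthogonalGroup (Fin L) ℝ) (hμ : ∀ i, 0 < μ i)
    (h : Uᵀ * obsCov A σ * U = Matrix.diagonal μ) :
    wienerMatrix A U μ * obsCov A σ = Aᵀ := by
  have h1 : Matrix.diagonal (fun i => (μ i)⁻¹) * Matrix.diagonal μ = 1 := by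
    rw [Matrix.diagonal_mul_diagonal, ← Matrix.diagonal_one]
    congr 1
    ext i
    exact inv_mul_cancel₀ (hμ i).ne'
  calc wienerMatrix A U μ * obsCov A σ
      = Aᵀ * U * Matrix.diagonal (fun i => (μ i)⁻¹) * (Uᵀ * U) * Matrix.diagonal μ * Uᵀ := by
        rw [eq_conj_diagonal hU h, wienerMatrix]
        simp only [Matrix.mul_assoc]
    _ = Aᵀ * U * (Matrix.diagonal (fun i => (μ i)⁻¹) * Matrix.diagonal μ) * Uᵀ := by
        rw [transpose_mul_self_of_mem_orthogonalGroup hU, Matrix.mul_one]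
        simp only [Matrix.mul_assoc]
    _ = Aᵀ * (U * Uᵀ) := by rw [h1, Matrix.mul_one, Matrix.mul_assoc]
    _ = Aᵀ := by rw [self_mul_transpose_of_mem_orthogonalGroup hU, Matrix.mul_one]

/-- Cyclicity of the trace brings `Uᵀ A` next to `Aᵀ U`, whose product is diagonal. Used with the
noise variances as `D`, and with `D = μ` for the energy of the estimate from `Y`. -/
lemma trace_wienerMatrix_mul (hU : U ∈ Matrix.orthogonalGroup (Fin L) ℝ) {lam : Fin L → ℝ}
    (h : Uᵀ * (A * Aᵀ) * U = Matrix.diagonal lam) (D : Fin L → ℝ) :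
    (wienerMatrix A U μ * U * Matrix.diagonal D * (wienerMatrix A U μ * U)ᵀ).trace =
      ∑ i, lam i * D i / μ i ^ 2 := by
  have h1 : wienerMatrix A U μ * U = Aᵀ * U * Matrix.diagonal (fun i => (μ i)⁻¹) := by
    rw [wienerMatrix, Matrix.mul_assoc, transpose_mul_self_of_mem_orthogonalGroup hU,
      Matrix.mul_one]
  rw [h1, Matrix.transpose_mul, Matrix.transpose_mul, Matrix.transpose_transpose,
    Matrix.diagonal_transpose]
  rw [show Aᵀ * U * Matrix.diagonal (fun i => (μ i)⁻¹) * Matrix.diagonal D *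
      (Matrix.diagonal (fun i => (μ i)⁻¹) * (Uᵀ * A)) =
      Aᵀ * U * (Matrix.diagonal (fun i => (μ i)⁻¹) * Matrix.diagonal D *
        Matrix.diagonal (fun i => (μ i)⁻¹) * (Uᵀ * A)) by simp only [Matrix.mul_assoc],
    Matrix.trace_mul_comm,
    show Matrix.diagonal (fun i => (μ i)⁻¹) * Matrix.diagonal D *
        Matrix.diagonal (fun i => (μ i)⁻¹) * (Uᵀ * A) * (Aᵀ * U) =
      Matrix.diagonal (fun i => (μ i)⁻¹) * Matrix.diagonal D *
        Matrix.diagonal (fun i => (μ i)⁻¹) * (Uᵀ * (A * Aᵀ) * U) by simp only [Matrix.mul_assoc],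
    h]
  simp only [Matrix.diagonal_mul_diagonal, Matrix.trace_diagonal]
  refine Finset.sum_congr rfl fun i _ => ?_
  ring

lemma ceDistortion_eq_sum (hU : U ∈ Matrix.orthogonalGroup (Fin L) ℝ) (hμ : ∀ i, 0 < μ i)
    (h : Uᵀ * obsCov A σ * U = Matrix.diagonal μ) {lam : Fin L → ℝ}
    (hlam : Uᵀ * (A * Aᵀ) * U = Matrix.diagonal lam) {D : Fin L → ℝ} (hD : ∀ i, 0 ≤ D i)
    (κ : Kernel (EuclideanSpace ℝ (Fin L)) (EuclideanSpace ℝ (Fin L))) [IsMarkovKernel κ]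
    {P : Measure (EuclideanSpace ℝ (Fin L))} [IsProbabilityMeasure P]
    (hκ : obsRecLaw A σ κ = (P.prod (multivariateGaussian 0 (Matrix.diagonal D))).map
      (fun p => (p.1 + U.toEuclideanLin p.2, p.1))) :
    ceDistortion A σ κ = 1 / (M : ℝ) * (M - ∑ i, lam i * (μ i - D i) / μ i ^ 2) := by
  have hB := wienerMatrix_mul_obsCov hU hμ h
  rw [ceDistortion_of_backward_channel A σ hB κ (Matrix.PosSemidef.diagonal hD) hκ,
    trace_wienerMatrix_mul hU hlam]
  have h1 : wienerMatrix A U μ * obsCov A σ * (wienerMatrix A U μ)ᵀ =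
      wienerMatrix A U μ * U * Matrix.diagonal μ * (wienerMatrix A U μ * U)ᵀ := by
    conv_lhs => rw [eq_conj_diagonal hU h]
    rw [Matrix.transpose_mul]
    simp only [Matrix.mul_assoc]
  rw [h1, trace_wienerMatrix_mul hU hlam]
  congr 1
  rw [sub_add, ← Finset.sum_sub_distrib]
  congr 1
  refine Finset.sum_congr rfl fun i _ => ?_
  ring

/-- Giving `Ŷ` the variances `μ - D` in the basis `U` and adding `U Z` produces the covariance
`Σ_Y`. The forward channel is the conditional law of `Ŷ` given `Y` under this joint law. -/
lemma exists_backward_channel (hU : U ∈ Matrix.orthogonalGroup (Fin L) ℝ)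
    (h : Uᵀ * obsCov A σ * U = Matrix.diagonal μ) {D : Fin L → ℝ} (hD : ∀ i, 0 ≤ D i)
    (hDμ : ∀ i, D i ≤ μ i) :
    ∃ κ : Kernel (EuclideanSpace ℝ (Fin L)) (EuclideanSpace ℝ (Fin L)), IsMarkovKernel κ ∧
      obsRecLaw A σ κ =
        ((obsRecLaw A σ κ).snd.prod (multivariateGaussian 0 (Matrix.diagonal D))).map
          (fun p => (p.1 + U.toEuclideanLin p.2, p.1)) := by
  have hS : (Matrix.diagonal fun i => μ i - D i).PosSemidef :=
    Matrix.PosSemidef.diagonal fun i => sub_nonneg.2 (hDμ i)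
  have hS' : (U * (Matrix.diagonal fun i => μ i - D i) * Uᵀ).PosSemidef := by
    simpa using hS.mul_mul_conjTranspose_same U
  have hT : (Matrix.diagonal D).PosSemidef := Matrix.PosSemidef.diagonal hD
  have hT' : (U * Matrix.diagonal D * Uᵀ).PosSemidef := by
    simpa using hT.mul_mul_conjTranspose_same U
  set P := multivariateGaussian 0 (U * (Matrix.diagonal fun i => μ i - D i) * Uᵀ)
  set ρ := (P.prod (multivariateGaussian 0 (Matrix.diagonal D))).map
    (fun p => (p.1 + U.toEuclideanLin p.2, p.1)) with hρ
  have : IsProbabilityMeasure ρ := Measure.isProbabilityMeasure_map (by fun_prop)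
  have hfst : ρ.fst = multivariateGaussian 0 (obsCov A σ) := by
    have h1 : obsCov A σ =
        U * (Matrix.diagonal fun i => μ i - D i) * Uᵀ + U * Matrix.diagonal D * Uᵀ := by
      rw [eq_conj_diagonal hU h, ← Matrix.add_mul, ← Matrix.mul_add, Matrix.diagonal_add]
      simp
    rw [h1, ← map_add_prod_multivariateGaussian hS' hT',
      ← map_toEuclideanLin_multivariateGaussian U hT]
    conv_rhs => rw [← Measure.map_id (μ := multivariateGaussian 0 (U * _ * Uᵀ)),
      Measure.map_prod_map _ _ measurable_id (by fun_prop),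
      Measure.map_map (by fun_prop) (by fun_prop)]
    rw [hρ, Measure.fst, Measure.map_map (by fun_prop) (by fun_prop)]
    rfl
  have hsnd : ρ.snd = P := by
    rw [hρ, Measure.snd, Measure.map_map (by fun_prop) (by fun_prop)]
    change Measure.map Prod.fst _ = _
    rw [Measure.map_fst_prod]
    simp
  refine ⟨ρ.condKernel, inferInstance, ?_⟩
  rw [obsRecLaw_eq_compProd, ← hfst, ρ.disintegrate, hsnd]

end

end TestChannel

/-- The compress-and-estimate distortion-rate function; no rank condition on `A` is needed. -/
theorem isCEDRF_waterLevel {M L : ℕ} (hM : 0 < M)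
    (A : Matrix (Fin L) (Fin M) ℝ) {σ : ℝ} (hσ : 0 < σ) {k : ℕ} (hk : 1 ≤ k)
    (hkr : k ≤ (obsCov A σ).rank) {R : ℝ}
    (hR : rateThreshold (obsCov A σ) k < (R : EReal))
    (hR' : (R : EReal) ≤ rateThreshold (obsCov A σ) (k + 1)) :
    IsCEDRF A σ R
      (1 - 1 / (M : ℝ) * ∑ l ∈ Finset.Icc 1 k,
          nthEigenvalue (A * Aᵀ) l /
            (nthEigenvalue (A * Aᵀ) l + σ ^ 2)
        + waterLevel (obsCov A σ) k R / (M : ℝ) *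
          ∑ l ∈ Finset.Icc 1 k,
            nthEigenvalue (A * Aᵀ) l /
              (nthEigenvalue (A * Aᵀ) l + σ ^ 2) ^ 2) := by
  rw [rank_obsCov A hσ] at hkr
  set lam := nthEigenvalue (A * Aᵀ) with hlam
  set m : ℕ → ℝ := fun l => lam l + σ ^ 2 with hm_def
  have hpred : ∀ l ∈ Finset.Icc 1 L, ∃ i : Fin L, (i : ℕ) + 1 = l := by
    intro l hl
    rw [Finset.mem_Icc] at hl
    exact ⟨⟨l - 1, by omega⟩, by simp; omega⟩
  have hobs : ∀ l ∈ Finset.Icc 1 L, nthEigenvalue (obsCov A σ) l = m l := by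
    intro l hl
    obtain ⟨i, rfl⟩ := hpred l hl
    exact nthEigenvalue_obsCov A σ i
  have hpos : ∀ l ∈ Finset.Icc 1 L, 0 < m l := by
    intro l hl
    obtain ⟨i, rfl⟩ := hpred l hl
    have := nthEigenvalue_gram_nonneg A i
    simp only [hm_def, hlam]
    positivity
  have hanti : ∀ l ∈ Finset.Icc 1 L, ∀ l' ∈ Finset.Icc 1 L, l ≤ l' → m l' ≤ m l := by
    intro l hl l' hl' hle
    obtain ⟨i, rfl⟩ := hpred l hl
    obtain ⟨j, rfl⟩ := hpred l' hl'
    have := antitone_nthEigenvalue (posSemidef_self_mul_transpose A).isHermitian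
      (show i ≤ j by simpa using hle)
    simpa [hm_def, hlam] using this
  have hsub : Finset.Icc 1 k ⊆ Finset.Icc 1 L := Finset.Icc_subset_Icc_right hkr
  have hposk : ∀ l ∈ Finset.Icc 1 k, 0 < m l := fun l hl => hpos l (hsub hl)
  have hlevel : waterLevel (obsCov A σ) k R = activeLevel m k R := by
    rw [waterLevel, activeLevel, Finset.prod_congr rfl fun l hl => hobs l (hsub hl)]
  have hthr : ∀ j, 1 ≤ j → j ≤ L → rateThreshold (obsCov A σ) j =
      ((1 / 2 * ∑ l ∈ Finset.Icc 1 j, Real.logb 2 (m l / m j) : ℝ) : EReal) := by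
    intro j hj hjL
    rw [rateThreshold, rank_obsCov A hσ, if_pos hjL]
    -- The separate value `0` at `j = 1` agrees with the general formula, since `log₂ (m 1 / m 1) =
    -- 0`.
    split_ifs with h1
    · subst h1
      simp [(hpos 1 (by simpa using hjL)).ne']
    · rw [Finset.sum_congr rfl fun l hl => by
        rw [hobs l (Finset.Icc_subset_Icc_right hjL hl), hobs j (by simp; omega)]]
  have hRk := hR
  rw [hthr k hk hkr, EReal.coe_lt_coe_iff] at hRk
  -- Positivity lets the real rate be recovered from `ENNReal.ofReal R`, which truncates negative
  -- numbers.
  have hR0 : 0 < R := by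
    refine lt_of_le_of_lt ?_ hRk
    refine mul_nonneg (by norm_num) (Finset.sum_nonneg fun l hl => ?_)
    refine Real.logb_nonneg one_lt_two ?_
    rw [one_le_div (hposk k (by simpa using hk))]
    exact hanti l (hsub hl) k (hsub (by simpa using hk)) (Finset.mem_Icc.1 hl).2
  have hltk := activeLevel_lt hk hposk hRk
  have hle : ∀ l ∈ Finset.Icc 1 k, activeLevel m k R ≤ m l := fun l hl =>
    hltk.le.trans (hanti l (hsub hl) k (hsub (by simpa using hk)) (Finset.mem_Icc.1 hl).2)
  -- If `k = L` the range is empty, so the infinite threshold is never evaluated.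
  have hge : ∀ l ∈ Finset.Icc (k + 1) L, m l ≤ activeLevel m k R := by
    intro l hl
    rw [Finset.mem_Icc] at hl
    have hkL : k + 1 ≤ L := hl.1.trans hl.2
    rw [hthr (k + 1) (by omega) hkL, EReal.coe_le_coe_iff] at hR'
    exact (hanti (k + 1) (by simp; omega) l (by simp; omega) hl.1).trans
      (le_activeLevel hk (fun l hl => hpos l (Finset.Icc_subset_Icc_right hkL hl)) hR')
  have hrate := waterFillingRate_activeLevel hk hkr hpos hle hge
  have hpos' : ∀ i : Fin L, 0 < lam (i + 1) + σ ^ 2 := fun i => hpos (i + 1) (by simp)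
  have hMI : ∀ {U : Matrix (Fin L) (Fin L) ℝ} (hU : U ∈ Matrix.orthogonalGroup (Fin L) ℝ)
      (hd : Uᵀ * obsCov A σ * U = Matrix.diagonal fun l : Fin L => lam (l + 1) + σ ^ 2)
      {θ : ℝ} (hθ : 0 < θ) (κ : Kernel (EuclideanSpace ℝ (Fin L)) (EuclideanSpace ℝ (Fin L)))
      [IsMarkovKernel κ] (hκ : obsRecLaw A σ κ = ((obsRecLaw A σ κ).snd.prod
        (multivariateGaussian 0 (Matrix.diagonal
          (fun l : Fin L => min (lam (l + 1) + σ ^ 2) θ)))).map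
            (fun p => (p.1 + U.toEuclideanLin p.2, p.1))),
      mutualInfoBits (obsRecLaw A σ κ) = ENNReal.ofReal (waterFillingRate L m θ) := by
    intro U hU hd θ hθ κ _ hκ
    rw [mutualInfoBits_backward_channel hU (fun i => lt_min (hpos' i) hθ) hpos' _ hκ
      (by rw [fst_obsRecLaw, ← eq_conj_diagonal hU hd]), waterFillingRate,
      ← sum_fin_succ_eq_sum_Icc (fun l => Real.logb 2 (m l / min (m l) θ))]
  have hLpos : 1 ≤ L := hk.trans hkr
  refine ⟨?_, ?_⟩
  · obtain ⟨U, hU, hd⟩ := exists_orthogonal_diagonalization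
      (posSemidef_self_mul_transpose A).isHermitian
    have hd' := (transpose_mul_obsCov_mul (σ := σ) hU _).2 hd
    have hθ : 0 < activeLevel m k R := activeLevel_pos hposk
    obtain ⟨κ, hκm, hκ⟩ := exists_backward_channel (D := fun l : Fin L =>
      min (lam (l + 1) + σ ^ 2) (activeLevel m k R)) hU hd'
      (fun i => (lt_min (hpos' i) hθ).le) (fun i => min_le_left _ _)
    exact ⟨κ, hκm, by rw [hMI hU hd' hθ κ hκ, hrate], U, hU, hd', _, hθ, hκ⟩
  · rintro κ hκm ⟨hI, U, hU, hd', θ, hθ, hκ⟩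
    rw [hMI hU hd' hθ κ hκ] at hI
    have hIR : waterFillingRate L m θ = R := by
      by_cases h0 : 0 ≤ waterFillingRate L m θ
      · exact (ENNReal.ofReal_eq_ofReal_iff h0 hR0.le).1 hI
      · rw [ENNReal.ofReal_of_nonpos (not_le.1 h0).le, eq_comm, ENNReal.ofReal_eq_zero] at hI
        linarith
    have hθeq := eq_activeLevel_of_waterFillingRate_eq hk hkr hpos
      (hltk.trans_le (hanti 1 (by simpa using hLpos) k (hsub (by simpa using hk)) hk))
      hrate hθ hIR
    rw [← hθeq] at hle hge
    have hdl := (transpose_mul_obsCov_mul hU _).1 hd'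
    rw [ceDistortion_eq_sum hU hpos' hd' hdl (fun i => (lt_min (hpos' i) hθ).le) κ hκ,
      sum_fin_succ_eq_sum_Icc (fun l => lam l * (m l - min (m l) θ) / m l ^ 2),
      sum_Icc_min_eq hkr hle hge (fun l x => lam l * (m l - x) / m l ^ 2), hlevel, ← hθeq]
    have hM' : (M : ℝ) ≠ 0 := by positivity
    have h1 : ∑ l ∈ Finset.Icc 1 k, lam l * (m l - θ) / m l ^ 2 =
        ∑ l ∈ Finset.Icc 1 k, lam l / m l - θ * ∑ l ∈ Finset.Icc 1 k, lam l / m l ^ 2 := by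
      rw [Finset.mul_sum, ← Finset.sum_sub_distrib]
      refine Finset.sum_congr rfl fun l hl => ?_
      have := (hposk l hl).ne'
      field_simp
    -- Inactive components have `D_l = m l`, hence contribute nothing to the reduction of the error.
    simp only [sub_self, mul_zero, zero_div, Finset.sum_const_zero, add_zero, h1]
    simp only [hm_def]
    field_simp
    ring

end CompressEstimate

end

theorem proposition2 (M L : ℕ) (hM : 0 < M) (A : Matrix (Fin L) (Fin M) ℝ)
    (hA : A.rank = min M L) (σ : ℝ) (hσ : 0 < σ) (k : ℕ) (hk : 1 ≤ k)
    (hkr : k ≤ (CompressEstimate.obsCov A σ).rank) (R : ℝ)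
    (hR : CompressEstimate.rateThreshold (CompressEstimate.obsCov A σ) k < (R : EReal))
    (hR' : (R : EReal) ≤ CompressEstimate.rateThreshold (CompressEstimate.obsCov A σ) (k + 1)) :
    CompressEstimate.IsCEDRF A σ R
      (1 - 1 / (M : ℝ) * ∑ l ∈ Finset.Icc 1 k,
          CompressEstimate.nthEigenvalue (A * Aᵀ) l /
            (CompressEstimate.nthEigenvalue (A * Aᵀ) l + σ ^ 2)
        + CompressEstimate.waterLevel (CompressEstimate.obsCov A σ) k R / (M : ℝ) *
          ∑ l ∈ Finset.Icc 1 k,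
            CompressEstimate.nthEigenvalue (A * Aᵀ) l /
              (CompressEstimate.nthEigenvalue (A * Aᵀ) l + σ ^ 2) ^ 2) :=
  CompressEstimate.isCEDRF_waterLevel hM A hσ hk hkr hR hR'
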